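/- **Theorem (generalization error for soft label propagation of one-dimensional distributions).** For $\mu,\nu\in\mathcal P(\mathbb R)$ let $W_2^2(\mu,\nu)=\inf_\pi\iint|x-y|^2\,d\pi(x,y)\in[0,\infty]$, the infimum over all couplings $\pi$ of $\mu$ and $\nu$, and let $F_\mu^{-1}(s)=\inf\{x: F_\mu(x)>s\}$ be the generalized inverse of the distribution function of $\mu$. Let $\phi\in L^2[0,1]$, $\phi\ge 0$, and let $\mathcal M_\phi^2$ be the set of $\mu\in\mathcal P(\mathbb R)$ with $|F_\mu^{-1}(s)|\le\phi(s)$ for a.e. $s\in[0,1]$. Let $V$ be a finite set, let $D$ be a probability measure on $V\times\mathcal P(\mathbb R)$ with $D(V\times\mathcal M_\phi^2)=1$, and let $\gamma>0$ and $m\ge 4$. A training set is $S=((v_1,\mu_1),\dots,(v_m,\mu_m))\sim D^m$; its maximal multiplicity is $T(S)=\max_{v\in V}\#\{i: v_i=v\}$. For $f:V\to\mathcal P(\mathbb R)$ put $$R_m(f)=\frac1m\sum_{i=1}^m W_2^2(f(v_i),\mu_i),\qquad R_D(f)=\mathbb E_{(j,\theta)\sim D}\,W_2^2(f(j),\theta).$$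 Consider either of the following two situations. 1. (Graph.) $G$ is a connected simple graph on $V$ with edge weights $\omega_{ij}=\omega_{ji}>0$, $\lambda_1$ is the smallest non-zero eigenvalue of its weighted Laplacian, and for $D^m$-almost every $S$ the map $f_S:V\to\mathcal P(\mathbb R)$ minimizes $$f\mapsto \frac1m\sum_{i=1}^m W_2^2(\mu_i,f(v_i))+\gamma\sum_{\{i,j\}\in E(G)}\omega_{ij}W_2^2(f(i),f(j))$$ over all maps $f:V\to\mathcal P(\mathbb R)$. 2. (Hypergraph.) $\mathcal E$ is a set of subsets of $V$ (hyperedges), $G$ is the clique graph, in which $i\ne j$ are adjacent iff some $E\in\mathcal E$ contains both, with weights $\omega_{ij}=\sum_{E\in\mathcal E,\ \{i,j\}\subset E}|E|^{-2}$; $G$ is connected, $\lambda_1$ is the smallest non-zero eigenvalue of its weighted Laplacian, and for $D^m$-almost every $S$ the map $f_S$ minimizes $$f\mapsto \frac1m\sum_{i=1}^m W_2^2(\mu_i,f(v_i))+\gamma\sum_{E\in\mathcal E}\ \inf_{\nu\in\mathcal P(\mathbb R)}\frac1{|E|}\sum_{i\in E}W_2^2(f(i),\nu)$$ over all maps $f:V\to\mathcal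 P(\mathbb R)$. Let $T\ge 1$ be an integer with $m\gamma\lambda_1>T$, and set $$M=4\|\phi\|_2^2,\qquad \beta=4\|\phi\|_2^2\left[\frac{3\sqrt{Tm}}{(m\gamma\lambda_1-T)^2}+\frac{4}{m\gamma\lambda_1-T}+\frac2m\right].$$ Then for every $\epsilon>0$: if $m\ge 8M^2/\epsilon^2$, then $$\mathbb P_{S\sim D^m}\{T(S)\le T,\ |R_m(f_S)-R_D(f_S)|>\epsilon\}\le\frac{64Mm\beta+8M^2}{m\epsilon^2},$$ and without this restriction on $m$ $$\mathbb P_{S\sim D^m}\{T(S)\le T,\ |R_m(f_S)-R_D(f_S)|>\epsilon+\beta\}\le 2\exp\left(-\frac{m\epsilon^2}{2(m\beta+M)^2}\right),$$ where for $M=0$ the right-hand side of the second bound is read as $2$. If $T\ge m$, the condition $T(S)\le T$ always holds and may be omitted. -/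

import Mathlib

open MeasureTheory
open scoped ENNReal

noncomputable section

namespace SoftLabel

/-- The squared `2`-Wasserstein distance of two probability measures on `ℝ`: the infimum over all
couplings `π` of the transport cost `∬ |x - y|² dπ(x, y)`, with value in `[0, ∞]`. -/
def W2sq (μ ν : ProbabilityMeasure ℝ) : ℝ≥0∞ :=
  ⨅ (π : Measure (ℝ × ℝ))
    (_ : π.map Prod.fst = (μ : Measure ℝ) ∧ π.map Prod.snd = (ν : Measure ℝ)),
    ∫⁻ p, edist p.1 p.2 ^ 2 ∂π

/-- The generalized inverse `s ↦ inf {x | F_μ(x) > s}` of the distribution function of `μ`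
(meaningful for `0 < s < 1`). -/
def quantile (μ : ProbabilityMeasure ℝ) (s : ℝ) : ℝ :=
  sInf {x : ℝ | s < ProbabilityTheory.cdf (μ : Measure ℝ) x}

/-- The dominated quantile class: `|F_μ⁻¹(s)| ≤ φ(s)` for almost every `s ∈ [0, 1]`. -/
def dominatedQuantileClass (φ : ℝ → ℝ) : Set (ProbabilityMeasure ℝ) :=
  {μ | ∀ᵐ s ∂(volume.restrict (Set.Icc (0 : ℝ) 1)), |quantile μ s| ≤ φ s}

/-- `‖φ‖₂²` in `L²[0, 1]`. -/
def sqNorm (φ : ℝ → ℝ) : ℝ := ∫ s in Set.Icc (0 : ℝ) 1, φ s ^ 2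

/-- An undirected simple graph with symmetric weights, positive exactly on the edges. -/
structure WeightedGraph (V : Type*) where
  graph : SimpleGraph V
  weight : V → V → ℝ
  weight_symm : ∀ i j, weight i j = weight j i
  weight_pos : ∀ i j, graph.Adj i j → 0 < weight i j
  weight_eq_zero : ∀ i j, ¬ graph.Adj i j → weight i j = 0

section Graph

variable {V : Type*} [Fintype V] [DecidableEq V]

/-- The weighted Laplacian: degree matrix minus weighted adjacency matrix. -/
def WeightedGraph.laplacian (G : WeightedGraph V) : Matrix V V ℝ :=
  Matrix.diagonal (fun i => ∑ j, G.weight i j) - Matrix.of G.weight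

/-- `l` is the smallest non-zero eigenvalue of the Laplacian of `G`. -/
def WeightedGraph.IsSpectralGap (G : WeightedGraph V) (l : ℝ) : Prop :=
  IsLeast {x : ℝ | x ≠ 0 ∧ Module.End.HasEigenvalue (Matrix.toLin' G.laplacian) x} l

/-- The weighted clique graph of the hypergraph on `V` with set of hyperedges `𝓔`: distinct vertices are adjacent if they lie in a
common hyperedge, and the edge `{i, j}` has weight `∑ 1 / |E|²` over the hyperedges `E`
that contain `i` and `j`. -/
def cliqueGraph (𝓔 : Finset (Finset V)) : WeightedGraph V where
  graph :=
    { Adj := fun i j => i ≠ j ∧ ∃ E ∈ 𝓔, i ∈ E ∧ j ∈ E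
      symm := ⟨fun _ _ h => ⟨h.1.symm, h.2.imp fun _ hE => ⟨hE.1, hE.2.2, hE.2.1⟩⟩⟩
      loopless := ⟨fun _ h => h.1 rfl⟩ }
  weight := fun i j =>
    if i = j then 0
    else ∑ E ∈ 𝓔.filter (fun E => i ∈ E ∧ j ∈ E), 1 / (E.card : ℝ) ^ 2
  weight_symm := fun i j => by
    simp only [eq_comm (a := i) (b := j), and_comm (a := i ∈ _)]
  weight_pos := fun i j h => by
    obtain ⟨hij, E, hE, hi, hj⟩ := h
    rw [if_neg hij]
    refine Finset.sum_pos (fun F hF => ?_) ⟨E, Finset.mem_filter.2 ⟨hE, hi, hj⟩⟩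
    have : 0 < F.card := Finset.card_pos.2 ⟨i, (Finset.mem_filter.1 hF).2.1⟩
    positivity
  weight_eq_zero := fun i j h => by
    split_ifs with hij
    · rfl
    · refine Finset.sum_eq_zero fun F hF => ?_
      have hF' := Finset.mem_filter.1 hF
      exact absurd ⟨hij, F, hF'.1, hF'.2⟩ h

/-- The data term `(1/m) ∑ᵢ W₂²(μᵢ, f(vᵢ))` of a training set `S = ((v₁, μ₁), …, (vₘ, μₘ))`;
it is also the empirical risk of `f` for the cost `c(f, (j, θ)) = W₂²(f(j), θ)`. -/
def empiricalRisk {m : ℕ} (S : Fin m → V × ProbabilityMeasure ℝ)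
    (f : V → ProbabilityMeasure ℝ) : ℝ≥0∞ :=
  (m : ℝ≥0∞)⁻¹ * ∑ i, W2sq (f (S i).1) (S i).2

/-- The Tikhonov objective on a weighted graph. Half of the sum over ordered pairs of vertices
counts every edge once. -/
def graphObjective (G : WeightedGraph V) (γ : ℝ) {m : ℕ}
    (S : Fin m → V × ProbabilityMeasure ℝ) (f : V → ProbabilityMeasure ℝ) : ℝ≥0∞ :=
  empiricalRisk S f +
    ENNReal.ofReal γ *
      (2⁻¹ * ∑ i, ∑ j, ENNReal.ofReal (G.weight i j) * W2sq (f i) (f j))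

/-- The barycenter value `inf_ν (1/|E|) ∑_{i ∈ E} W₂²(f(i), ν)` of a hyperedge. -/
def bar (f : V → ProbabilityMeasure ℝ) (E : Finset V) : ℝ≥0∞ :=
  ⨅ ν : ProbabilityMeasure ℝ, (E.card : ℝ≥0∞)⁻¹ * ∑ i ∈ E, W2sq (f i) ν

/-- The Tikhonov objective on the hypergraph on `V` with set of hyperedges `𝓔`. -/
def hypergraphObjective (𝓔 : Finset (Finset V)) (γ : ℝ) {m : ℕ}
    (S : Fin m → V × ProbabilityMeasure ℝ) (f : V → ProbabilityMeasure ℝ) : ℝ≥0∞ :=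
  empiricalRisk S f + ENNReal.ofReal γ * ∑ E ∈ 𝓔, bar f E

/-- The largest number of times that a vertex occurs in the training set. -/
def maxMultiplicity {m : ℕ} (S : Fin m → V × ProbabilityMeasure ℝ) : ℕ :=
  Finset.univ.sup fun v : V => (Finset.univ.filter fun i => (S i).1 = v).card

/-- The generalization error `E_{(j, θ) ∼ D} W₂²(f(j), θ)`. -/
def trueRisk [MeasurableSpace V] (D : Measure (V × ProbabilityMeasure ℝ))
    (f : V → ProbabilityMeasure ℝ) : ℝ≥0∞ :=
  ∫⁻ z, W2sq (f z.1) z.2 ∂D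

/-- `|R_m(f) - R_D(f)|`. -/
def riskGap [MeasurableSpace V] (D : Measure (V × ProbabilityMeasure ℝ)) {m : ℕ}
    (S : Fin m → V × ProbabilityMeasure ℝ) (f : V → ProbabilityMeasure ℝ) : ℝ :=
  |(empiricalRisk S f).toReal - (trueRisk D f).toReal|

/-- The two bounds for the learning algorithm `S ↦ A S`, on the event that no vertex occurs more
than `T` times in the training set (the sure event if `m ≤ T`). -/
def GeneralizationBounds [MeasurableSpace V] (D : Measure (V × ProbabilityMeasure ℝ)) {m : ℕ}
    (A : (Fin m → V × ProbabilityMeasure ℝ) → V → ProbabilityMeasure ℝ)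
    (T : ℕ) (M β : ℝ) : Prop :=
  ∀ ε : ℝ, 0 < ε →
    (8 * M ^ 2 / ε ^ 2 ≤ m →
      Measure.pi (fun _ : Fin m => D) {S | maxMultiplicity S ≤ T ∧ ε < riskGap D S (A S)} ≤
        ENNReal.ofReal ((64 * M * m * β + 8 * M ^ 2) / (m * ε ^ 2))) ∧
    Measure.pi (fun _ : Fin m => D) {S | maxMultiplicity S ≤ T ∧ ε + β < riskGap D S (A S)} ≤
      ENNReal.ofReal (2 * Real.exp (-(m * ε ^ 2 / (2 * (m * β + M) ^ 2))))

end Graph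

/-- The stability constant
`4‖φ‖₂² [3√(Tm) / (mγλ₁ - T)² + 4 / (mγλ₁ - T) + 2 / m]`. -/
def beta (φ : ℝ → ℝ) (m T : ℕ) (γ l : ℝ) : ℝ :=
  4 * sqNorm φ *
    (3 * √((T : ℝ) * m) / (m * γ * l - T) ^ 2 + 4 / (m * γ * l - T) + 2 / m)

end SoftLabel

end

/-! On the line, `W2sq` is the squared L² distance of quantile functions on (0, 1)
(`W2sq_eq_lintegral_quantile`). Hence the graph objective is an integral over levels s of scalar
Tikhonov problems, one per level. The scalar minimizer solves (n + cL)x = b, where c = mγ, L is the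
Laplacian, n counts the labels at each vertex and b sums them. By the minimum principle the solution
is monotone in the labels, so the levelwise solutions are again increasing in s, hence quantile
functions. This identifies every minimizer (`quantile_minimizer_ae_eq`). A barycenter on the line
averages quantiles, so the variance identity turns the hypergraph penalty into the clique graph
penalty (`hypergraphObjective_eq`).

Stability is a statement about this linear system. Both the old and the new solution are compared
with the one in which the replaced label is deleted. Adding a label at v acts through the diagonal
Green function k(v), and `green_diag_le` gives k(v) ≤ κ = 1/m + 2/(cλ₁) however the labels are
distributed over the vertices. A maximum principle then yields |x − (1 − κ)x₀| ≤ κa when all labels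
are bounded by a. The cost therefore changes by at most β₀ = 8κ‖φ‖₂² ≤ β when one sample is
replaced, for all training sets; restricting to small multiplicity only shrinks the bad event.

The rest is the theory of uniformly stable algorithms. Resampling one coordinate bounds the mean gap
by β₀ and the second moment by 3Mβ₀ + M²/m; Chebyshev gives the first bound. McDiarmid's inequality
with differences 2β₀ + M/m gives the second. -/

namespace SoftLabel

/-! ### Quantile functions as transports of the uniform distribution -/

section Quantile

open ProbabilityTheory Set

/-- The uniform distribution on the open unit interval. -/
noncomputable def unif : Measure ℝ := volume.restrict (Ioo (0 : ℝ) 1)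

theorem unif_eq_restrict_Icc : unif = volume.restrict (Icc (0 : ℝ) 1) :=
  restrict_Ioo_eq_restrict_Icc

instance : IsProbabilityMeasure unif := ⟨by simp [unif]⟩

theorem ae_unif_mem : ∀ᵐ s ∂unif, s ∈ Ioo (0 : ℝ) 1 := ae_restrict_mem measurableSet_Ioo

theorem quantileSet_nonempty (μ : ProbabilityMeasure ℝ) {s : ℝ} (hs : s < 1) :
    {x : ℝ | s < cdf (μ : Measure ℝ) x}.Nonempty :=
  ((tendsto_cdf_atTop (μ : Measure ℝ)).eventually (lt_mem_nhds hs)).exists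

theorem quantileSet_bddBelow (μ : ProbabilityMeasure ℝ) {s : ℝ} (hs : 0 < s) :
    BddBelow {x : ℝ | s < cdf (μ : Measure ℝ) x} := by
  obtain ⟨a, ha⟩ :=
    ((tendsto_cdf_atBot (μ : Measure ℝ)).eventually (gt_mem_nhds hs)).exists
  refine ⟨a, fun x hx => ?_⟩
  by_contra! h
  exact absurd (hx.trans_le (monotone_cdf (μ : Measure ℝ) h.le)) (not_lt.2 ha.le)

theorem quantile_le_of_lt_cdf (μ : ProbabilityMeasure ℝ) {s x : ℝ} (hs : 0 < s)
    (h : s < cdf (μ : Measure ℝ) x) : quantile μ s ≤ x :=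
  csInf_le (quantileSet_bddBelow μ hs) h

theorem lt_cdf_of_quantile_lt (μ : ProbabilityMeasure ℝ) {s x : ℝ} (hs : s < 1)
    (h : quantile μ s < x) : s < cdf (μ : Measure ℝ) x := by
  obtain ⟨y, hy, hyx⟩ := exists_lt_of_csInf_lt (quantileSet_nonempty μ hs) h
  exact lt_of_lt_of_le hy (monotone_cdf (μ : Measure ℝ) hyx.le)

/-- Right continuity of the distribution function passes the strict inequality at all y > x to the
limit; strictness is lost at atoms. -/
theorem le_cdf_of_quantile_le (μ : ProbabilityMeasure ℝ) {s x : ℝ} (hs : s < 1)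
    (h : quantile μ s ≤ x) : s ≤ cdf (μ : Measure ℝ) x := by
  have hc : Filter.Tendsto (cdf (μ : Measure ℝ)) (nhdsWithin x (Ioi x))
      (nhds (cdf (μ : Measure ℝ) x)) :=
    ((cdf (μ : Measure ℝ)).right_continuous x).mono_left (nhdsWithin_mono _ Ioi_subset_Ici_self)
  refine ge_of_tendsto hc ?_
  filter_upwards [self_mem_nhdsWithin] with y hy
  exact (lt_cdf_of_quantile_lt μ hs (h.trans_lt hy)).le

theorem monotoneOn_quantile (μ : ProbabilityMeasure ℝ) : MonotoneOn (quantile μ) (Ioo 0 1) := by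
  intro s hs t ht hst
  exact csInf_le_csInf (quantileSet_bddBelow μ hs.1) (quantileSet_nonempty μ ht.2)
    fun x hx => lt_of_le_of_lt hst hx

theorem aemeasurable_quantile (μ : ProbabilityMeasure ℝ) : AEMeasurable (quantile μ) unif :=
  aemeasurable_restrict_of_monotoneOn measurableSet_Ioo (monotoneOn_quantile μ)

theorem unif_Iio {t : ℝ} (h1 : t ≤ 1) : unif (Iio t) = ENNReal.ofReal t := by
  rw [unif, Measure.restrict_apply measurableSet_Iio]
  have : Iio t ∩ Ioo 0 1 = Ioo 0 t := by
    ext s; simp only [mem_inter_iff, mem_Iio, mem_Ioo]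
    exact ⟨fun h => ⟨h.2.1, h.1⟩, fun h => ⟨h.2, h.1, h.2.trans_le h1⟩⟩
  rw [this, Real.volume_Ioo, sub_zero]

theorem unif_Iic_le (t : ℝ) : unif (Iic t) ≤ ENNReal.ofReal t := by
  rw [unif, Measure.restrict_apply measurableSet_Iic]
  calc _ ≤ volume (Ioc 0 t) := measure_mono fun s hs => ⟨hs.2.1, hs.1⟩
    _ = _ := by rw [Real.volume_Ioc, sub_zero]

/-- The quantile function transports the uniform distribution to `μ`. -/
theorem map_quantile (μ : ProbabilityMeasure ℝ) : unif.map (quantile μ) = (μ : Measure ℝ) := by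
  have : IsProbabilityMeasure (unif.map (quantile μ)) :=
    Measure.isProbabilityMeasure_map (aemeasurable_quantile μ)
  refine Measure.ext_of_Iic _ _ fun x => ?_
  rw [Measure.map_apply_of_aemeasurable (aemeasurable_quantile μ) measurableSet_Iic, ← ofReal_cdf]
  apply le_antisymm
  · calc unif (quantile μ ⁻¹' Iic x) ≤ unif (Iic (cdf (μ : Measure ℝ) x)) := by
          refine measure_mono_ae ?_
          filter_upwards [ae_unif_mem] with s hs h
          exact le_cdf_of_quantile_le μ hs.2 h
      _ ≤ _ := unif_Iic_le _
  · rw [← unif_Iio (cdf_le_one _ x)]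
    refine measure_mono_ae ?_
    filter_upwards [ae_unif_mem] with s hs h
    exact quantile_le_of_lt_cdf μ hs.1 h

/-- A monotone function on the unit interval is almost everywhere the quantile function of its
distribution. -/
theorem quantile_map_ae_eq {x : ℝ → ℝ} (hx : MonotoneOn x (Ioo 0 1)) (ν : ProbabilityMeasure ℝ)
    (hν : (ν : Measure ℝ) = unif.map x) : quantile ν =ᵐ[unif] x := by
  have hxm : AEMeasurable x unif := aemeasurable_restrict_of_monotoneOn measurableSet_Ioo hx
  have hcdf : ∀ t, ENNReal.ofReal (cdf (ν : Measure ℝ) t) = unif (x ⁻¹' Iic t) := fun t => by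
    rw [ofReal_cdf, hν, Measure.map_apply_of_aemeasurable hxm measurableSet_Iic]
  have hle : ∀ s ∈ Ioo (0 : ℝ) 1, x s ≤ quantile ν s := by
    intro s hs
    by_contra! h
    -- For t strictly between the two values, ν has mass more than s on (-∞, t], although x ≤ t can
    -- only hold at levels below s.
    obtain ⟨t, ht1, ht2⟩ := exists_between h
    have h1 := lt_cdf_of_quantile_lt ν hs.2 ht1
    have h2 : unif (x ⁻¹' Iic t) ≤ ENNReal.ofReal s := by
      rw [← unif_Iio hs.2.le]
      refine measure_mono_ae ?_
      filter_upwards [ae_unif_mem] with r hr h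
      refine lt_of_not_ge (α := ℝ) fun hsr => ?_
      exact absurd ((hx hs hr hsr).trans h) (not_le.2 ht2)
    rw [← hcdf, ENNReal.ofReal_le_ofReal_iff hs.1.le] at h2
    linarith
  have hge : ∀ s ∈ Ioo (0 : ℝ) 1, ∀ r ∈ Ioo (0 : ℝ) 1, s < r → quantile ν s ≤ x r := by
    intro s hs r hr hsr
    refine quantile_le_of_lt_cdf ν hs.1 (lt_of_lt_of_le hsr ?_)
    rw [← ENNReal.ofReal_le_ofReal_iff (cdf_nonneg _ _), hcdf, ← unif_Iio hr.2.le]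
    refine measure_mono_ae ?_
    filter_upwards [ae_unif_mem] with t ht h
    exact hx ht hr (le_of_lt h)
  -- For s < r the quantile is squeezed between x s and x r. A monotone function has countably many
  -- discontinuities, and elsewhere r ↓ s gives equality.
  have hcount := hx.countable_not_continuousWithinAt
  have hae : ∀ᵐ s ∂unif, s ∉ {t ∈ Ioo (0 : ℝ) 1 | ¬ContinuousWithinAt x (Ioo 0 1) t} :=
    ae_restrict_of_ae (hcount.ae_notMem volume)
  filter_upwards [ae_unif_mem, hae] with s hs hs'
  have hcont : ContinuousAt x s := by
    have : ContinuousWithinAt x (Ioo 0 1) s := by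
      by_contra h
      exact hs' ⟨hs, h⟩
    exact this.continuousAt (Ioo_mem_nhds hs.1 hs.2)
  refine le_antisymm ?_ (hle s hs)
  refine ge_of_tendsto (hcont.tendsto.mono_left (nhdsWithin_le_nhds (s := Ioi s))) ?_
  filter_upwards [Ioo_mem_nhdsGT hs.2] with r hr
  exact hge s hs r ⟨hs.1.trans hr.1, hr.2⟩ hr.1

/-- Every monotone function on the unit interval is almost everywhere a quantile function. -/
theorem exists_quantile_ae_eq {x : ℝ → ℝ} (hx : MonotoneOn x (Ioo 0 1)) :
    ∃ ν : ProbabilityMeasure ℝ, quantile ν =ᵐ[unif] x := by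
  have hxm : AEMeasurable x unif := aemeasurable_restrict_of_monotoneOn measurableSet_Ioo hx
  exact ⟨⟨unif.map x, Measure.isProbabilityMeasure_map hxm⟩, quantile_map_ae_eq hx _ rfl⟩

/-- The quantile function is jointly measurable in the measure and the level. -/
theorem measurable_quantile_prod :
    Measurable fun p : ProbabilityMeasure ℝ × ℝ =>
      (Prod.snd ⁻¹' Ioo (0 : ℝ) 1).indicator (fun p => quantile p.1 p.2) p := by
  have hcdf : ∀ r : ℝ, Measurable fun p : ProbabilityMeasure ℝ × ℝ =>
      cdf (p.1 : Measure ℝ) r := fun r => by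
    have : (fun p : ProbabilityMeasure ℝ × ℝ => cdf (p.1 : Measure ℝ) r)
        = fun p => ((p.1 : Measure ℝ) (Iic r)).toReal := by
      funext p; rw [cdf_eq_real]; rfl
    rw [this]
    exact ((Measure.measurable_coe measurableSet_Iic).comp
      (measurable_subtype_coe.comp measurable_fst)).ennreal_toReal
  have hI : MeasurableSet (Prod.snd ⁻¹' Ioo (0 : ℝ) 1 : Set (ProbabilityMeasure ℝ × ℝ)) :=
    measurable_snd measurableSet_Ioo
  refine measurable_of_Iio fun x => ?_
  -- A quantile lies below x iff the level is below the distribution function at some rational r <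
  -- x, a countable union. Off (0, 1) the indicator is 0, which leaves the condition 0 < x.
  have : (fun p : ProbabilityMeasure ℝ × ℝ =>
      (Prod.snd ⁻¹' Ioo (0 : ℝ) 1).indicator (fun p => quantile p.1 p.2) p) ⁻¹' Iio x
      = ((Prod.snd ⁻¹' Ioo (0 : ℝ) 1) ∩ ⋃ r : ℚ, {p : ProbabilityMeasure ℝ × ℝ | (r : ℝ) < x ∧
          p.2 < cdf (p.1 : Measure ℝ) r}) ∪ ((Prod.snd ⁻¹' Ioo (0 : ℝ) 1)ᶜ ∩ {_p | 0 < x}) := by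
    ext p
    by_cases hp : p ∈ (Prod.snd ⁻¹' Ioo (0 : ℝ) 1 : Set (ProbabilityMeasure ℝ × ℝ))
    · simp only [mem_preimage, indicator_of_mem hp, mem_Iio, mem_union, mem_inter_iff, mem_compl_iff,
        mem_iUnion, mem_ofPred_eq]
      have hp' : p.2 ∈ Ioo (0 : ℝ) 1 := hp
      simp only [hp', true_and, not_true_eq_false, false_and, or_false]
      constructor
      · intro h
        obtain ⟨r, h1, h2⟩ := exists_rat_btwn h
        exact ⟨r, h2, lt_cdf_of_quantile_lt _ hp'.2 h1⟩
      · rintro ⟨r, h1, h2⟩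
        exact (quantile_le_of_lt_cdf _ hp'.1 h2).trans_lt h1
    · have hp' : ¬ p.2 ∈ Ioo (0 : ℝ) 1 := hp
      simp [hp']
  rw [this]
  refine (hI.inter (MeasurableSet.iUnion fun r => ?_)).union (hI.compl.inter (.const _))
  exact (MeasurableSet.const _).inter (measurableSet_lt measurable_snd (hcdf r))

end Quantile

/-! ### Optimality of the quantile coupling -/

section Wasserstein

open ProbabilityTheory Set

/-- The squares `[y, x)²` have area `(x - y)²`. -/
theorem volume_square (x y : ℝ) :
    (volume : Measure (ℝ × ℝ)) {p | y ≤ p.1 ⊓ p.2 ∧ p.1 ⊔ p.2 < x} = ENNReal.ofReal (x - y) ^ 2 := by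
  have : {p : ℝ × ℝ | y ≤ p.1 ⊓ p.2 ∧ p.1 ⊔ p.2 < x} = Ico y x ×ˢ Ico y x := by
    ext p; simp only [mem_ofPred_eq, le_inf_iff, sup_lt_iff, mem_prod, mem_Ico]; tauto
  rw [this, Measure.volume_eq_prod, Measure.prod_prod, Real.volume_Ico, sq]

theorem edist_sq_eq (x y : ℝ) :
    edist x y ^ 2 = ENNReal.ofReal (x - y) ^ 2 + ENNReal.ofReal (y - x) ^ 2 := by
  rw [edist_dist, Real.dist_eq]
  rcases le_total x y with h | h
  · rw [ENNReal.ofReal_of_nonpos (sub_nonpos.2 h), abs_of_nonpos (sub_nonpos.2 h)]; simp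
  · rw [ENNReal.ofReal_of_nonpos (p := y - x) (sub_nonpos.2 h), abs_of_nonneg (sub_nonneg.2 h)]
    simp

/-- The layer-cake formula for the quadratic transport cost. -/
theorem lintegral_edist_sq (π : Measure (ℝ × ℝ)) [SFinite π] :
    ∫⁻ z, edist z.1 z.2 ^ 2 ∂π = ∫⁻ p : ℝ × ℝ,
      (π {z | z.2 ≤ p.1 ⊓ p.2 ∧ p.1 ⊔ p.2 < z.1} + π {z | z.1 ≤ p.1 ⊓ p.2 ∧ p.1 ⊔ p.2 < z.2}) := by
  have hA : MeasurableSet {q : (ℝ × ℝ) × (ℝ × ℝ) |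
      q.1.2 ≤ q.2.1 ⊓ q.2.2 ∧ q.2.1 ⊔ q.2.2 < q.1.1} :=
    (measurableSet_le (f := fun q : (ℝ × ℝ) × (ℝ × ℝ) => q.1.2) (g := fun q => q.2.1 ⊓ q.2.2)
      (by fun_prop) (by fun_prop)).inter
      (measurableSet_lt (f := fun q : (ℝ × ℝ) × (ℝ × ℝ) => q.2.1 ⊔ q.2.2) (g := fun q => q.1.1)
        (by fun_prop) (by fun_prop))
  have hB : MeasurableSet {q : (ℝ × ℝ) × (ℝ × ℝ) |
      q.1.1 ≤ q.2.1 ⊓ q.2.2 ∧ q.2.1 ⊔ q.2.2 < q.1.2} :=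
    (measurableSet_le (f := fun q : (ℝ × ℝ) × (ℝ × ℝ) => q.1.1) (g := fun q => q.2.1 ⊓ q.2.2)
      (by fun_prop) (by fun_prop)).inter
      (measurableSet_lt (f := fun q : (ℝ × ℝ) × (ℝ × ℝ) => q.2.1 ⊔ q.2.2) (g := fun q => q.1.2)
        (by fun_prop) (by fun_prop))
  have h1 := Measure.prod_apply (μ := π) (ν := (volume : Measure (ℝ × ℝ))) hA
  have h2 := Measure.prod_apply (μ := π) (ν := (volume : Measure (ℝ × ℝ))) hB
  rw [Measure.prod_apply_symm hA] at h1
  rw [Measure.prod_apply_symm hB] at h2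
  simp only [preimage_ofPred_eq, volume_square] at h1 h2
  rw [lintegral_add_left, h1, h2, ← lintegral_add_left]
  · simp only [edist_sq_eq]
  · fun_prop
  · exact measurable_measure_prodMk_right hA

/-- In dimension one the squared Wasserstein distance is the squared `L²` distance of the quantile
functions. -/
theorem W2sq_eq_lintegral_quantile (μ ν : ProbabilityMeasure ℝ) :
    W2sq μ ν = ∫⁻ s, edist (quantile μ s) (quantile ν s) ^ 2 ∂unif := by
  have hpair : AEMeasurable (fun s => (quantile μ s, quantile ν s)) unif :=
    (aemeasurable_quantile μ).prodMk (aemeasurable_quantile ν)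
  have hcost : ∫⁻ s, edist (quantile μ s) (quantile ν s) ^ 2 ∂unif
      = ∫⁻ z, edist z.1 z.2 ^ 2 ∂(unif.map fun s => (quantile μ s, quantile ν s)) := by
    rw [lintegral_map' _ hpair]
    exact ((measurable_fst.edist measurable_snd).pow_const 2).aemeasurable
  apply le_antisymm
  · rw [hcost]
    refine iInf₂_le _ ⟨?_, ?_⟩
    · rw [AEMeasurable.map_map_of_aemeasurable measurable_fst.aemeasurable hpair]
      exact map_quantile μ
    · rw [AEMeasurable.map_map_of_aemeasurable measurable_snd.aemeasurable hpair]
      exact map_quantile ν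
  · refine le_iInf₂ fun π hπ => ?_
    have hfin : IsFiniteMeasure π := by
      refine ⟨?_⟩
      have : π univ = (π.map Prod.fst) univ := by rw [Measure.map_apply measurable_fst .univ]; rfl
      rw [this, hπ.1]; simp
    -- Optimality is checked layer by layer: any coupling gives {h ≤ c, d < g} at least the mass
    -- F_ν'(c) − F_μ'(d), truncated at 0, and the quantile coupling gives it no more than that.
    have key : ∀ (μ' ν' : ProbabilityMeasure ℝ) (g h : ℝ × ℝ → ℝ), Measurable g → Measurable h →
        π.map g = (μ' : Measure ℝ) → π.map h = (ν' : Measure ℝ) → ∀ c d : ℝ,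
        unif {s | quantile ν' s ≤ c ∧ d < quantile μ' s} ≤ π {z | h z ≤ c ∧ d < g z} := by
      intro μ' ν' g h hg hh hgm hhm c d
      calc unif {s | quantile ν' s ≤ c ∧ d < quantile μ' s}
          ≤ unif (Icc (cdf (μ' : Measure ℝ) d) (cdf (ν' : Measure ℝ) c)) := by
            refine measure_mono_ae ?_
            filter_upwards [ae_unif_mem] with s hs h
            refine ⟨?_, le_cdf_of_quantile_le _ hs.2 h.1⟩
            by_contra! hlt
            exact absurd (quantile_le_of_lt_cdf _ hs.1 hlt) (not_le.2 h.2)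
        _ ≤ volume (Icc (cdf (μ' : Measure ℝ) d) (cdf (ν' : Measure ℝ) c)) :=
            Measure.restrict_apply_le _ _
        _ = ENNReal.ofReal (cdf (ν' : Measure ℝ) c) - ENNReal.ofReal (cdf (μ' : Measure ℝ) d) := by
            rw [Real.volume_Icc, ENNReal.ofReal_sub _ (cdf_nonneg _ _)]
        _ = π (h ⁻¹' Iic c) - π (g ⁻¹' Iic d) := by
            rw [ofReal_cdf, ofReal_cdf, ← hgm, ← hhm, Measure.map_apply hg measurableSet_Iic,
              Measure.map_apply hh measurableSet_Iic]
        _ ≤ π (h ⁻¹' Iic c \ g ⁻¹' Iic d) := le_measure_sdiff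
        _ ≤ _ := by
            refine measure_mono fun z hz => ⟨hz.1, ?_⟩
            exact not_le.1 hz.2
    rw [hcost, lintegral_edist_sq, lintegral_edist_sq]
    have hm : ∀ c d : ℝ, MeasurableSet {z : ℝ × ℝ | z.2 ≤ c ∧ d < z.1} := fun c d =>
      (measurableSet_le measurable_snd measurable_const).inter
        (measurableSet_lt measurable_const measurable_fst)
    have hm' : ∀ c d : ℝ, MeasurableSet {z : ℝ × ℝ | z.1 ≤ c ∧ d < z.2} := fun c d =>
      (measurableSet_le measurable_fst measurable_const).inter
        (measurableSet_lt measurable_const measurable_snd)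
    refine lintegral_mono fun p => add_le_add ?_ ?_
    · rw [Measure.map_apply_of_aemeasurable hpair (hm _ _)]
      exact key μ ν Prod.fst Prod.snd measurable_fst measurable_snd hπ.1 hπ.2 _ _
    · rw [Measure.map_apply_of_aemeasurable hpair (hm' _ _)]
      exact key ν μ Prod.snd Prod.fst measurable_snd measurable_fst hπ.2 hπ.1 _ _

end Wasserstein

theorem WeightedGraph.weight_nonneg {V : Type*} (G : WeightedGraph V) (i j : V) : 0 ≤ G.weight i j := by
  by_cases h : G.graph.Adj i j
  · exact (G.weight_pos i j h).le
  · exact (G.weight_eq_zero i j h).ge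

/-! ### Dirichlet energy and spectral gap -/

section Laplacian

open Matrix Finset

variable {V : Type*} [Fintype V] [DecidableEq V] (G : WeightedGraph V)

theorem WeightedGraph.laplacian_mulVec (x : V → ℝ) (i : V) :
    (G.laplacian *ᵥ x) i = ∑ j, G.weight i j * (x i - x j) := by
  simp only [WeightedGraph.laplacian, sub_mulVec, Pi.sub_apply, mulVec_diagonal, mul_sub,
    sum_sub_distrib, sum_mul]
  rfl

theorem WeightedGraph.dotProduct_laplacian (y x : V → ℝ) :
    y ⬝ᵥ (G.laplacian *ᵥ x) = 2⁻¹ * ∑ i, ∑ j, G.weight i j * ((y i - y j) * (x i - x j)) := by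
  have h1 : y ⬝ᵥ (G.laplacian *ᵥ x) = ∑ i, ∑ j, G.weight i j * (y i * (x i - x j)) := by
    simp only [dotProduct, G.laplacian_mulVec, mul_sum]
    exact sum_congr rfl fun i _ => sum_congr rfl fun j _ => by ring
  have h2 : ∑ i, ∑ j, G.weight i j * (y i * (x i - x j))
      = ∑ i, ∑ j, G.weight i j * (y j * (x j - x i)) := by
    rw [sum_comm]
    exact sum_congr rfl fun i _ => sum_congr rfl fun j _ => by rw [G.weight_symm]
  have h3 : ∑ i, ∑ j, G.weight i j * ((y i - y j) * (x i - x j))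
      = ∑ i, ∑ j, G.weight i j * (y i * (x i - x j))
        + ∑ i, ∑ j, G.weight i j * (y j * (x j - x i)) := by
    simp only [← sum_add_distrib]
    exact sum_congr rfl fun i _ => sum_congr rfl fun j _ => by ring
  rw [h1, h3, ← h2]; ring

theorem WeightedGraph.dotProduct_laplacian_self_nonneg (x : V → ℝ) :
    0 ≤ x ⬝ᵥ (G.laplacian *ᵥ x) := by
  rw [G.dotProduct_laplacian]
  refine mul_nonneg (by norm_num) (sum_nonneg fun i _ => sum_nonneg fun j _ => ?_)
  exact mul_nonneg (G.weight_nonneg i j) (mul_self_nonneg _)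

/-- All summands of the energy are nonnegative, so each edge difference vanishes; a walk carries the
equality from i to j. -/
theorem WeightedGraph.eq_of_energy_eq_zero (hG : G.graph.Connected) {x : V → ℝ}
    (hx : x ⬝ᵥ (G.laplacian *ᵥ x) = 0) (i j : V) : x i = x j := by
  rw [G.dotProduct_laplacian, mul_eq_zero, or_iff_right (by norm_num)] at hx
  have hnn : ∀ i j, 0 ≤ G.weight i j * ((x i - x j) * (x i - x j)) := fun i j =>
    mul_nonneg (G.weight_nonneg i j) (mul_self_nonneg _)
  have hadj : ∀ i j, G.graph.Adj i j → x i = x j := by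
    intro i j hij
    have h1 := (sum_eq_zero_iff_of_nonneg fun i _ => sum_nonneg fun j _ => hnn i j).1 hx i
      (mem_univ i)
    have h2 := (sum_eq_zero_iff_of_nonneg fun j _ => hnn i j).1 h1 j (mem_univ j)
    have h3 := (G.weight_pos i j hij).ne'
    have h4 : x i - x j = 0 := by simpa [h3] using h2
    linarith
  obtain ⟨p⟩ := hG.preconnected i j
  induction p with
  | nil => rfl
  | cons h _ ih => exact (hadj _ _ h).trans ih

theorem WeightedGraph.laplacian_isHermitian : G.laplacian.IsHermitian := by
  ext i j
  simp only [WeightedGraph.laplacian, conjTranspose_apply, star_trivial, Matrix.sub_apply,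
    Matrix.of_apply, G.weight_symm j i]
  by_cases h : i = j
  · subst h; rfl
  · rw [diagonal_apply_ne _ h, diagonal_apply_ne _ (Ne.symm h)]

/-- The Poincaré inequality on the orthogonal complement of the constants. -/
theorem WeightedGraph.spectralGap_mul_le (hG : G.graph.Connected) {l : ℝ} (hl : G.IsSpectralGap l)
    {x : V → ℝ} (hx : ∑ i, x i = 0) : l * ∑ i, x i ^ 2 ≤ x ⬝ᵥ (G.laplacian *ᵥ x) := by
  have hA := G.laplacian_isHermitian
  set e := hA.eigenvectorBasis with he
  set z : EuclideanSpace ℝ V := WithLp.toLp 2 x with hz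
  have hmul : ∀ k, G.laplacian *ᵥ (e k).ofLp = hA.eigenvalues k • (e k).ofLp := fun k =>
    hA.mulVec_eigenvectorBasis k
  have hadj : ∀ k, inner ℝ (e k) (WithLp.toLp 2 (G.laplacian *ᵥ x) : EuclideanSpace ℝ V)
      = hA.eigenvalues k * inner ℝ (e k) z := by
    intro k
    simp only [EuclideanSpace.inner_eq_star_dotProduct, star_trivial, hz]
    have hT : G.laplacianᵀ = G.laplacian := IsSymm.eq (by simpa using hA)
    calc (G.laplacian *ᵥ x) ⬝ᵥ (e k).ofLp = (G.laplacian *ᵥ (e k).ofLp) ⬝ᵥ x := by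
          rw [dotProduct_comm, dotProduct_mulVec, ← mulVec_transpose, hT]
      _ = _ := by rw [hmul, smul_dotProduct, smul_eq_mul, dotProduct_comm]
  have hen : x ⬝ᵥ (G.laplacian *ᵥ x) = ∑ k, hA.eigenvalues k * inner ℝ (e k) z ^ 2 := by
    have h := e.sum_inner_mul_inner z (WithLp.toLp 2 (G.laplacian *ᵥ x) : EuclideanSpace ℝ V)
    rw [EuclideanSpace.inner_eq_star_dotProduct] at h
    simp only [star_trivial, hz] at h
    rw [dotProduct_comm, ← h]
    refine sum_congr rfl fun k _ => ?_
    rw [hadj, real_inner_comm]; ring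
  have hnorm : ∑ i, x i ^ 2 = ∑ k, inner ℝ (e k) z ^ 2 := by
    have h := e.sum_sq_norm_inner_right z
    rw [EuclideanSpace.norm_sq_eq] at h
    simpa [hz] using h.symm
  rw [hen, hnorm, mul_sum]
  refine sum_le_sum fun k _ => ?_
  -- Eigenvectors in the kernel are constant, hence orthogonal to x; every other eigenvalue is at
  -- least l.
  by_cases h0 : hA.eigenvalues k = 0
  · have hker : (e k).ofLp ⬝ᵥ (G.laplacian *ᵥ (e k).ofLp) = 0 := by rw [hmul, h0]; simp
    have hconst := G.eq_of_energy_eq_zero hG hker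
    have : inner ℝ (e k) z = 0 := by
      obtain ⟨i₀⟩ := hG.nonempty
      simp only [EuclideanSpace.inner_eq_star_dotProduct, star_trivial, hz, dotProduct]
      simp only [hconst _ i₀, ← sum_mul, hx, zero_mul]
    simp [this]
  · refine mul_le_mul_of_nonneg_right (hl.2 ⟨h0, ?_⟩) (sq_nonneg _)
    refine Module.End.hasEigenvalue_of_hasEigenvector (x := (e k).ofLp) ?_
    rw [Module.End.hasEigenvector_iff, Module.End.mem_eigenspace_iff]
    refine ⟨hmul k, fun h => ?_⟩
    have := e.orthonormal.ne_zero k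
    exact this (by ext i; simpa using congrFun h i)

/-- Poincaré inequality for x minus its mean c, which has the same energy, keeping only the two
terms v and w. The factor 2 comes from (a − b)² ≤ 2(a² + b²). -/
theorem WeightedGraph.spectralGap_mul_sub_sq_le (hG : G.graph.Connected) {l : ℝ} (hl0 : 0 < l)
    (hl : G.IsSpectralGap l) (x : V → ℝ) (v w : V) :
    l * (x v - x w) ^ 2 ≤ 2 * (x ⬝ᵥ (G.laplacian *ᵥ x)) := by
  have := hG.nonempty
  set c : ℝ := (∑ i, x i) / Fintype.card V with hc
  have hcard : (Fintype.card V : ℝ) ≠ 0 := by exact_mod_cast Fintype.card_ne_zero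
  have h1 := G.spectralGap_mul_le hG hl (x := fun i => x i - c) (by
    rw [sum_sub_distrib, sum_const, card_univ, nsmul_eq_mul, hc]; field_simp; ring)
  have h2 : (fun i => x i - c) ⬝ᵥ (G.laplacian *ᵥ fun i => x i - c)
      = x ⬝ᵥ (G.laplacian *ᵥ x) := by
    simp only [G.dotProduct_laplacian, sub_sub_sub_cancel_right]
  rw [h2] at h1
  rcases eq_or_ne v w with rfl | hvw
  · simpa using G.dotProduct_laplacian_self_nonneg x
  have h3 : (x v - c) ^ 2 + (x w - c) ^ 2 ≤ ∑ i, (x i - c) ^ 2 := by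
    rw [← sum_pair hvw (f := fun i => (x i - c) ^ 2)]
    exact sum_le_sum_of_subset_of_nonneg (subset_univ _) fun _ _ _ => sq_nonneg _
  have h4 : (x v - x w) ^ 2 ≤ 2 * ∑ i, (x i - c) ^ 2 := by
    nlinarith [sq_nonneg ((x v - c) + (x w - c))]
  nlinarith

end Laplacian

/-! ### Screened Laplacian: maximum principle and Green function -/

section Green

open Matrix Finset

variable {V : Type*} [Fintype V] [DecidableEq V] (G : WeightedGraph V)

/-- The operator `n + c L` whose inverse propagates labels with vertex multiplicities `n`. -/
noncomputable def WeightedGraph.screened (c : ℝ) (n : V → ℝ) : Matrix V V ℝ :=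
  diagonal n + c • G.laplacian

variable {G} {c : ℝ} {n : V → ℝ}

theorem WeightedGraph.screened_mulVec (x : V → ℝ) (i : V) :
    (G.screened c n *ᵥ x) i = n i * x i + c * (G.laplacian *ᵥ x) i := by
  simp [WeightedGraph.screened, add_mulVec, mulVec_diagonal, smul_mulVec]

theorem WeightedGraph.dotProduct_screened (y x : V → ℝ) :
    y ⬝ᵥ (G.screened c n *ᵥ x) = ∑ i, n i * (y i * x i) + c * (y ⬝ᵥ (G.laplacian *ᵥ x)) := by
  simp only [dotProduct, G.screened_mulVec, mul_add, sum_add_distrib, mul_sum]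
  congr 1 <;> exact sum_congr rfl fun i _ => by ring

/-- Zero Laplacian energy makes x constant, and the mass term kills the constant at a vertex with n
> 0. This is the positive definiteness behind invertibility and uniqueness. -/
theorem WeightedGraph.eq_zero_of_screened_energy_nonpos (hG : G.graph.Connected) (hc : 0 < c)
    (hn : ∀ i, 0 ≤ n i) (hn' : ∃ i, 0 < n i) {x : V → ℝ}
    (hx : x ⬝ᵥ (G.screened c n *ᵥ x) ≤ 0) : x = 0 := by
  rw [G.dotProduct_screened] at hx
  have h1 : 0 ≤ ∑ i, n i * (x i * x i) :=
    sum_nonneg fun i _ => mul_nonneg (hn i) (mul_self_nonneg _)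
  have h2 := G.dotProduct_laplacian_self_nonneg x
  have h2' := mul_nonneg hc.le h2
  have h3 : x ⬝ᵥ (G.laplacian *ᵥ x) = 0 := by
    have : c * (x ⬝ᵥ (G.laplacian *ᵥ x)) = 0 := by linarith
    simpa [hc.ne'] using this
  have h4 : ∑ i, n i * (x i * x i) = 0 := by linarith
  obtain ⟨v, hv⟩ := hn'
  have h5 := (sum_eq_zero_iff_of_nonneg fun i _ => mul_nonneg (hn i) (mul_self_nonneg _)).1 h4 v
    (mem_univ v)
  have h6 : x v = 0 := by simpa [hv.ne'] using h5
  funext i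
  rw [G.eq_of_energy_eq_zero hG h3 i v, h6]; rfl

theorem WeightedGraph.isUnit_screened (hG : G.graph.Connected) (hc : 0 < c)
    (hn : ∀ i, 0 ≤ n i) (hn' : ∃ i, 0 < n i) : IsUnit (G.screened c n) := by
  rw [← mulVec_injective_iff_isUnit]
  intro x y hxy
  have h : G.screened c n *ᵥ (x - y) = 0 := by
    rw [mulVec_sub]; exact sub_eq_zero.2 hxy
  exact sub_eq_zero.1 (G.eq_zero_of_screened_energy_nonpos hG hc hn hn' (by rw [h]; simp))

theorem WeightedGraph.screened_mulVec_inv (hG : G.graph.Connected) (hc : 0 < c)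
    (hn : ∀ i, 0 ≤ n i) (hn' : ∃ i, 0 < n i) (b : V → ℝ) :
    G.screened c n *ᵥ ((G.screened c n)⁻¹ *ᵥ b) = b := by
  rw [mulVec_mulVec, mul_nonsing_inv _ ((isUnit_iff_isUnit_det _).1
    (G.isUnit_screened hG hc hn hn')), one_mulVec]

/-- The minimum principle: a function that is supersolution wherever it is negative is
nonnegative. -/
theorem WeightedGraph.nonneg_of_screened (hG : G.graph.Connected) (hc : 0 < c)
    (hn : ∀ i, 0 ≤ n i) (hn' : ∃ i, 0 < n i) {w : V → ℝ}
    (hw : ∀ i, w i < 0 → 0 ≤ (G.screened c n *ᵥ w) i) (i : V) : 0 ≤ w i := by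
  -- The negative part is the test function: truncation can only lower the quadratic form against w,
  -- so p has nonpositive energy and vanishes.
  set p : V → ℝ := fun i => min (w i) 0 with hp
  have h1 : p ⬝ᵥ (G.screened c n *ᵥ w) ≤ 0 := by
    refine sum_nonpos fun i _ => ?_
    rcases lt_or_ge (w i) 0 with h | h
    · exact mul_nonpos_of_nonpos_of_nonneg (min_le_right _ _) (hw i h)
    · simp [hp, h]
  have h2 : p ⬝ᵥ (G.screened c n *ᵥ p) ≤ p ⬝ᵥ (G.screened c n *ᵥ w) := by
    rw [G.dotProduct_screened, G.dotProduct_screened, G.dotProduct_laplacian,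
      G.dotProduct_laplacian]
    refine add_le_add (sum_le_sum fun i _ => mul_le_mul_of_nonneg_left ?_ (hn i))
      (mul_le_mul_of_nonneg_left (mul_le_mul_of_nonneg_left (sum_le_sum fun i _ =>
        sum_le_sum fun j _ => mul_le_mul_of_nonneg_left ?_ (G.weight_nonneg i j))
        (by norm_num)) hc.le)
    · simp only [hp]
      rcases le_total (w i) 0 with h | h <;> simp [h]
    · simp only [hp]
      rcases le_total (w i) 0 with h | h <;> rcases le_total (w j) 0 with h' | h' <;>
        simp only [min_eq_left, min_eq_right, h, h'] <;> nlinarith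
  have h3 := G.eq_zero_of_screened_energy_nonpos hG hc hn hn' (h2.trans h1)
  have h4 := congrFun h3 i
  simpa [hp] using h4

theorem WeightedGraph.screened_const (a : ℝ) (i : V) :
    (G.screened c n *ᵥ fun _ => a) i = n i * a := by
  rw [G.screened_mulVec, G.laplacian_mulVec]; simp

/-- The constants ±a are barriers: the Laplacian annihilates them, so the operator maps them to ±n
a, which dominates b. -/
theorem WeightedGraph.abs_le_of_screened (hG : G.graph.Connected) (hc : 0 < c)
    (hn : ∀ i, 0 ≤ n i) (hn' : ∃ i, 0 < n i) {x b : V → ℝ} {a : ℝ}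
    (hx : G.screened c n *ᵥ x = b) (hb : ∀ i, |b i| ≤ n i * a) (i : V) : |x i| ≤ a := by
  have h1 := G.nonneg_of_screened hG hc hn hn' (w := (fun _ => a) - x) (fun i _ => by
    rw [mulVec_sub, Pi.sub_apply, G.screened_const, hx]
    linarith [(abs_le.1 (hb i)).2]) i
  have h2 := G.nonneg_of_screened hG hc hn hn' (w := (fun _ => a) + x) (fun i _ => by
    rw [mulVec_add, Pi.add_apply, G.screened_const, hx]
    linarith [(abs_le.1 (hb i)).1]) i
  simp only [Pi.sub_apply, Pi.add_apply] at h1 h2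
  exact abs_le.2 ⟨by linarith, by linarith⟩

/-- The diagonal of the Green function is at most `1 / m + 2 / (c λ₁)` for total mass `m`,
regardless of how the mass is distributed. -/
theorem WeightedGraph.green_diag_le (hG : G.graph.Connected) (hc : 0 < c) (hn : ∀ i, 0 ≤ n i)
    {l : ℝ} (hl0 : 0 < l) (hl : G.IsSpectralGap l) {M : ℝ} (hM : 0 < M) (hnM : ∑ i, n i = M)
    {k : V → ℝ} {v : V} (hk : G.screened c n *ᵥ k = Pi.single v 1) :
    k v ≤ 1 / M + 2 / (c * l) := by
  -- Testing the equation with 1 gives that k has n-mean 1/M; testing it with k gives that its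
  -- energy equals k v.
  have h1 : ∑ i, n i * k i = 1 := by
    have h := congrArg (fun f => (fun _ : V => (1 : ℝ)) ⬝ᵥ f) hk
    simp only [G.dotProduct_screened, G.dotProduct_laplacian, dotProduct_single] at h
    simpa using h
  have h2 : ∑ i, n i * (k i * k i) + c * (k ⬝ᵥ (G.laplacian *ᵥ k)) = k v := by
    rw [← G.dotProduct_screened, hk, dotProduct_single, mul_one]
  have h3 : c * l * ∑ i, n i * (k v - k i) ^ 2 ≤ 2 * M * (c * (k ⬝ᵥ (G.laplacian *ᵥ k))) := by
    have : ∑ i, n i * (l * (k v - k i) ^ 2) ≤ ∑ i, n i * (2 * (k ⬝ᵥ (G.laplacian *ᵥ k))) :=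
      sum_le_sum fun i _ => mul_le_mul_of_nonneg_left
        (G.spectralGap_mul_sub_sq_le hG hl0 hl k v i) (hn i)
    rw [← sum_mul, hnM] at this
    calc _ = c * ∑ i, n i * (l * (k v - k i) ^ 2) := by
          rw [mul_assoc, mul_sum]; congr 1; exact sum_congr rfl fun i _ => by ring
      _ ≤ c * (M * (2 * (k ⬝ᵥ (G.laplacian *ᵥ k)))) := mul_le_mul_of_nonneg_left this hc.le
      _ = _ := by ring
  have h4 : ∑ i, n i * (k v - k i) ^ 2 = M * k v ^ 2 - 2 * k v + ∑ i, n i * (k i * k i) := by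
    have : ∀ i, n i * (k v - k i) ^ 2
        = n i * k v ^ 2 - 2 * k v * (n i * k i) + n i * (k i * k i) := fun i => by ring
    simp only [this, sum_add_distrib, sum_sub_distrib, ← sum_mul, ← mul_sum, hnM, h1, mul_one]
  -- The n-weighted variance of k about its mean 1/M is nonnegative.
  have h5 : 1 ≤ M * ∑ i, n i * (k i * k i) := by
    have : 0 ≤ ∑ i, n i * (M * k i - 1) ^ 2 :=
      sum_nonneg fun i _ => mul_nonneg (hn i) (sq_nonneg _)
    have e : ∀ i, n i * (M * k i - 1) ^ 2
        = M ^ 2 * (n i * (k i * k i)) - 2 * M * (n i * k i) + n i := fun i => by ring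
    simp only [e, sum_add_distrib, sum_sub_distrib, ← mul_sum, hnM, h1, mul_one] at this
    have h6 : 0 ≤ M * (M * ∑ i, n i * (k i * k i) - 1) := by linarith
    linarith [nonneg_of_mul_nonneg_right h6 hM]
  set s := ∑ i, n i * (k i * k i)
  have hcl : 0 < c * l := mul_pos hc hl0
  have h6 : c * l * (M * k v ^ 2 - 2 * k v + s) ≤ 2 * M * (k v - s) := by
    rw [← h4]; refine h3.trans_eq ?_; rw [← h2]; ring
  -- Let η be the excess of k v over 1/M. Replacing s by its lower bound 1/M on both sides of `h6`
  -- leaves c l M η² ≤ 2 M η, so η cannot exceed 2/(c l).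
  by_contra! hlt
  set η := k v - 1 / M with hη
  have hη' : 2 / (c * l) < η := by linarith
  have hs : 1 / M ≤ s := by rw [div_le_iff₀ hM]; linarith
  have hkv : k v = η + 1 / M := by rw [hη]; ring
  have h7 : M * k v ^ 2 - 2 * k v + 1 / M = M * η ^ 2 := by rw [hkv]; field_simp; ring
  have h8 : c * l * (M * η ^ 2) ≤ 2 * M * η := by
    rw [← h7]
    have : c * l * (M * k v ^ 2 - 2 * k v + 1 / M) ≤ c * l * (M * k v ^ 2 - 2 * k v + s) := by
      gcongr
    refine this.trans (h6.trans ?_)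
    rw [hkv]
    gcongr
    linarith
  have hηpos : 0 < η := lt_trans (by positivity) hη'
  rw [div_lt_iff₀ hcl] at hη'
  have : 0 < M * η * (η * (c * l) - 2) := mul_pos (mul_pos hM hηpos) (by linarith)
  nlinarith

/-- Effect of one additional label `y` at the vertex `v`. -/
theorem WeightedGraph.abs_sub_le_of_add_label (hG : G.graph.Connected) (hc : 0 < c)
    {n₀ : V → ℝ} (hn : ∀ i, 0 ≤ n₀ i) (hn' : ∃ i, 0 < n₀ i) {x₀ x b₀ k : V → ℝ} {a y κ : ℝ} {v : V}
    (hx₀ : G.screened c n₀ *ᵥ x₀ = b₀) (hb : ∀ i, |b₀ i| ≤ n₀ i * a) (hy : |y| ≤ a)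
    (hx : G.screened c (n₀ + Pi.single v 1) *ᵥ x = b₀ + Pi.single v y)
    (hk : G.screened c (n₀ + Pi.single v 1) *ᵥ k = Pi.single v 1) (hκ : k v ≤ κ) (i : V) :
    |x i - (1 - κ) * x₀ i| ≤ κ * a := by
  set n := n₀ + Pi.single v 1 with hnd
  have hN : ∀ i, 0 ≤ n i := fun i => by
    rw [hnd, Pi.add_apply]
    refine add_nonneg (hn i) ?_
    by_cases h : i = v
    · subst h; simp
    · simp [h]
  have hN' : ∃ i, 0 < n i := ⟨v, by simpa [hnd] using add_pos_of_nonneg_of_pos (hn v) one_pos⟩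
  have hk0 : 0 ≤ k v := G.nonneg_of_screened hG hc hN hN' (fun i _ => by
    rw [hk]; by_cases h : i = v
    · subst h; simp
    · simp [h]) v
  have hA : ∀ z, G.screened c n *ᵥ z = G.screened c n₀ *ᵥ z + Pi.single v (z v) := fun z => by
    funext i
    rw [Pi.add_apply, G.screened_mulVec, G.screened_mulVec, hnd]
    by_cases h : i = v
    · subst h; simp; ring
    · simp [h]
  have hAx₀ : G.screened c n *ᵥ x₀ = b₀ + Pi.single v (x₀ v) := by rw [hA, hx₀]
  -- The new label is a rank-one perturbation, so the solution moves along the Green function of v.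
  have hdiff : x = x₀ + (y - x₀ v) • k := by
    have hinj := mulVec_injective_iff_isUnit.2 (G.isUnit_screened hG hc hN hN')
    refine hinj ?_
    change G.screened c n *ᵥ x = G.screened c n *ᵥ _
    rw [mulVec_add, mulVec_smul, hx, hk, hAx₀]
    funext i
    by_cases h : i = v
    · subst h; simp
    · simp [h]
  have hxv : x v = x₀ v + (y - x₀ v) * k v := by
    conv_lhs => rw [hdiff]
    simp
  have hx₀a := G.abs_le_of_screened hG hc hn hn' hx₀ hb
  have hoff : ∀ i, i ≠ v → (G.screened c n *ᵥ x) i = b₀ i ∧ (G.screened c n *ᵥ x₀) i = b₀ i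
      ∧ n i = n₀ i := fun i hi => by
    rw [hx, hAx₀]; simp [hi, hnd]
  -- At v this barrier equals k v (a − y) ≥ 0, so it cannot be negative there. Away from v the
  -- operator sends it to k v (n₀ a − b₀) ≥ 0. The lower barrier is its mirror image.
  have hupper := G.nonneg_of_screened hG hc hN hN'
    (w := (fun _ => k v * a) - x + (1 - k v) • x₀) (fun i hi => by
      by_cases h : i = v
      · subst h
        simp only [Pi.add_apply, Pi.sub_apply, Pi.smul_apply, smul_eq_mul] at hi
        have : 0 ≤ k i * (a - y) := mul_nonneg hk0 (by linarith [(abs_le.1 hy).2])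
        nlinarith
      · obtain ⟨e1, e2, e3⟩ := hoff i h
        simp only [mulVec_add, mulVec_sub, mulVec_smul, Pi.add_apply, Pi.sub_apply, Pi.smul_apply,
          smul_eq_mul, G.screened_const, e1, e2, e3]
        have : 0 ≤ k v * (n₀ i * a - b₀ i) := mul_nonneg hk0 (by linarith [(abs_le.1 (hb i)).2])
        nlinarith)
  have hlower := G.nonneg_of_screened hG hc hN hN'
    (w := (fun _ => k v * a) + x - (1 - k v) • x₀) (fun i hi => by
      by_cases h : i = v
      · subst h
        simp only [Pi.add_apply, Pi.sub_apply, Pi.smul_apply, smul_eq_mul] at hi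
        have : 0 ≤ k i * (a + y) := mul_nonneg hk0 (by linarith [(abs_le.1 hy).1])
        nlinarith
      · obtain ⟨e1, e2, e3⟩ := hoff i h
        simp only [mulVec_add, mulVec_sub, mulVec_smul, Pi.add_apply, Pi.sub_apply, Pi.smul_apply,
          smul_eq_mul, G.screened_const, e1, e2, e3]
        have : 0 ≤ k v * (n₀ i * a + b₀ i) := mul_nonneg hk0 (by linarith [(abs_le.1 (hb i)).1])
        nlinarith)
  have hu := hupper i
  have hlo := hlower i
  simp only [Pi.add_apply, Pi.sub_apply, Pi.smul_apply, smul_eq_mul] at hu hlo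
  obtain ⟨ha1, ha2⟩ := abs_le.1 (hx₀a i)
  -- Since |x₀| ≤ a, the band around (1 − k v) x₀ of radius k v a grows with k v, so k v may be
  -- replaced by κ.
  have h1 : 0 ≤ (κ - k v) * (a - x₀ i) := mul_nonneg (by linarith) (by linarith)
  have h2 : 0 ≤ (κ - k v) * (a + x₀ i) := mul_nonneg (by linarith) (by linarith)
  exact abs_le.2 ⟨by nlinarith, by nlinarith⟩

end Green

/-! ### McDiarmid's bounded differences inequality -/

section BoundedDifferences

open ProbabilityTheory

theorem abs_integral_le_of_abs_le {α : Type*} [MeasurableSpace α] (μ : Measure α)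
    [IsProbabilityMeasure μ] {f : α → ℝ} {C : ℝ} (h : ∀ x, |f x| ≤ C) : |∫ x, f x ∂μ| ≤ C := by
  simpa using norm_integral_le_of_norm_le_const (μ := μ) (f := f) (ae_of_all _ h)

variable {Z : Type*} [MeasurableSpace Z] (D : Measure Z) [IsProbabilityMeasure D]

theorem measurable_update_prod {m : ℕ} (i : Fin m) :
    Measurable fun p : (Fin m → Z) × Z => Function.update p.1 i p.2 := by
  refine measurable_pi_lambda _ fun j => ?_
  by_cases h : j = i
  · subst h; simpa using measurable_snd
  · simp only [Function.update_of_ne h]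
    exact (measurable_pi_apply j).comp measurable_fst

/-- Replacing one coordinate by an independent copy preserves the product measure. -/
theorem measurePreserving_update {m : ℕ} (i : Fin m) :
    MeasurePreserving (fun p : (Fin m → Z) × Z => Function.update p.1 i p.2)
      ((Measure.pi fun _ => D).prod D) (Measure.pi fun _ => D) := by
  refine ⟨measurable_update_prod i, (Measure.pi_eq fun s hs => ?_).symm⟩
  rw [Measure.map_apply (measurable_update_prod i) (MeasurableSet.univ_pi hs)]
  have : (fun p : (Fin m → Z) × Z => Function.update p.1 i p.2) ⁻¹' (Set.univ.pi s)
      = (Set.univ.pi (Function.update s i Set.univ)) ×ˢ s i := by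
    ext p
    simp only [Set.mem_preimage, Set.mem_pi, Set.mem_univ, true_implies, Set.mem_prod]
    constructor
    · refine fun h => ⟨fun j => ?_, by simpa using h i⟩
      by_cases hj : j = i
      · subst hj; simp
      · simpa [Function.update_of_ne hj] using h j
    · rintro ⟨h, hi⟩ j
      by_cases hj : j = i
      · subst hj; simpa using hi
      · simpa [Function.update_of_ne hj] using h j
  rw [this, Measure.prod_prod, Measure.pi_pi,
    ← Finset.mul_prod_erase _ (fun j => D (s j)) (Finset.mem_univ i),
    ← Finset.mul_prod_erase _ _ (Finset.mem_univ i)]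
  simp only [Function.update_self, measure_univ, one_mul]
  rw [mul_comm]
  congr 1
  refine Finset.prod_congr rfl fun j hj => ?_
  rw [Function.update_of_ne (Finset.ne_of_mem_erase hj)]

/-- The moment generating function under the bounded differences property. -/
theorem integral_exp_le_of_bounded_differences {c : ℝ} :
    ∀ {n : ℕ} {F : (Fin n → Z) → ℝ} {B : ℝ}, Measurable F → (∀ S, |F S| ≤ B) →
      (∀ S i z, |F (Function.update S i z) - F S| ≤ c) → ∀ t : ℝ,
      ∫ S, Real.exp (t * (F S - ∫ S', F S' ∂(Measure.pi fun _ => D))) ∂(Measure.pi fun _ => D)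
        ≤ Real.exp (n * (c / 2) ^ 2 * t ^ 2 / 2) := by
  intro n
  induction n with
  | zero =>
    intro F B hF hB _ t
    have : ∀ S, F S = F default := fun S => by rw [Subsingleton.elim S default]
    simp [this]
  | succ n ih =>
    intro F B hF hB hd t
    set P : Measure (Fin n → Z) := Measure.pi fun _ => D with hP
    set P' : Measure (Fin (n + 1) → Z) := Measure.pi fun _ => D with hP'
    have hmp := (measurePreserving_piFinSuccAbove (fun _ : Fin (n + 1) => D) 0).symm
    have hcons : ∀ p : Z × (Fin n → Z),
        (MeasurableEquiv.piFinSuccAbove (fun _ : Fin (n + 1) => Z) 0).symm p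
          = (Fin.cons p.1 p.2 : Fin (n + 1) → Z) := fun p => by
      exact Fin.insertNth_zero' p.1 p.2
    have hmc : Measurable fun p : Z × (Fin n → Z) => (Fin.cons p.1 p.2 : Fin (n + 1) → Z) := by
      have := (MeasurableEquiv.piFinSuccAbove (fun _ : Fin (n + 1) => Z) 0).symm.measurable
      exact (funext hcons : _ = _) ▸ this
    have hintegral : ∀ H : (Fin (n + 1) → Z) → ℝ,
        ∫ S, H S ∂P' = ∫ p, H (Fin.cons p.1 p.2) ∂(D.prod P) := fun H => by
      have := hmp.integral_comp (MeasurableEquiv.measurableEmbedding _) H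
      simp only [hcons] at this
      exact this.symm
    have hB0 : ∀ z, Measurable fun S : Fin n → Z => F (Fin.cons z S) := fun z =>
      hF.comp (hmc.comp measurable_prodMk_left)
    have hFc : Measurable fun p : Z × (Fin n → Z) => F (Fin.cons p.1 p.2) := hF.comp hmc
    have hFi : Integrable (fun p : Z × (Fin n → Z) => F (Fin.cons p.1 p.2)) (D.prod P) :=
      Integrable.of_bound hFc.aestronglyMeasurable B (ae_of_all _ fun p => hB _)
    have hFi' : ∀ z, Integrable (fun S : Fin n → Z => F (Fin.cons z S)) P := fun z =>
      Integrable.of_bound (hB0 z).aestronglyMeasurable B (ae_of_all _ fun p => hB _)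
    -- Induction step: g is the conditional mean given the first coordinate. It inherits the bound c
    -- on differences, so its range lies in an interval of length c and Hoeffding's lemma applies; F
    -- − g is handled by the induction hypothesis.
    set g : Z → ℝ := fun z => ∫ S, F (Fin.cons z S) ∂P with hg
    have hgm : Measurable g :=
      (StronglyMeasurable.integral_prod_right hFc.stronglyMeasurable).measurable
    have hEF : ∫ S, F S ∂P' = ∫ z, g z ∂D := by rw [hintegral, integral_prod _ hFi]
    have hgd : ∀ z z', |g z - g z'| ≤ c := by
      intro z z'
      rw [hg]
      simp only
      rw [← integral_sub (hFi' z) (hFi' z')]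
      have : ∀ S : Fin n → Z, |F (Fin.cons z S) - F (Fin.cons z' S)| ≤ c := fun S => by
        have := hd (Fin.cons z' S) 0 z
        rwa [Fin.update_cons_zero] at this
      exact abs_integral_le_of_abs_le P this
    obtain ⟨z₀⟩ : Nonempty Z := nonempty_of_isProbabilityMeasure D
    have hbdd : BddBelow (Set.range g) := by
      refine ⟨g z₀ - c, ?_⟩
      rintro _ ⟨z, rfl⟩
      linarith [(abs_le.1 (hgd z z₀)).1]
    have hIcc : ∀ z, g z ∈ Set.Icc (⨅ z, g z) ((⨅ z, g z) + c) := fun z => by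
      have : Nonempty Z := ⟨z₀⟩
      refine ⟨ciInf_le hbdd z, ?_⟩
      have : g z - c ≤ ⨅ z, g z := le_ciInf fun z' => by linarith [(abs_le.1 (hgd z z')).2]
      linarith
    have hsub := hasSubgaussianMGF_of_mem_Icc (μ := D) hgm.aemeasurable (ae_of_all _ hIcc)
    have houter : ∫ z, Real.exp (t * (g z - ∫ z', g z' ∂D)) ∂D
        ≤ Real.exp ((c / 2) ^ 2 * t ^ 2 / 2) := by
      have := hsub.mgf_le t
      simp only [mgf, add_sub_cancel_left] at this
      refine this.trans_eq ?_
      congr 2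
      simp [div_pow, sq_abs]
    have hinner : ∀ z, ∫ S, Real.exp (t * (F (Fin.cons z S) - g z)) ∂P
        ≤ Real.exp (n * (c / 2) ^ 2 * t ^ 2 / 2) := fun z => by
      refine ih (hB0 z) (B := B) (fun S => hB _) (fun S i z' => ?_) t
      rw [Fin.cons_update]
      exact hd _ _ _
    have hbE : |∫ S, F S ∂P'| ≤ B := by
      exact abs_integral_le_of_abs_le P' hB
    have hEi : Integrable (fun p : Z × (Fin n → Z) =>
        Real.exp (t * (F (Fin.cons p.1 p.2) - ∫ S, F S ∂P'))) (D.prod P) := by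
      refine Integrable.of_bound ((hFc.sub_const _).const_mul t).exp.aestronglyMeasurable
        (Real.exp (|t| * (2 * B))) (ae_of_all _ fun p => ?_)
      rw [Real.norm_eq_abs, Real.abs_exp]
      refine Real.exp_le_exp.2 ((le_abs_self _).trans ?_)
      rw [abs_mul]
      gcongr
      exact (abs_sub _ _).trans (by linarith [hB (Fin.cons p.1 p.2)])
    rw [hintegral fun S => Real.exp (t * (F S - ∫ S', F S' ∂P')), integral_prod _ hEi]
    calc ∫ z, ∫ S, Real.exp (t * (F (Fin.cons z S) - ∫ S', F S' ∂P')) ∂P ∂D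
        = ∫ z, Real.exp (t * (g z - ∫ z', g z' ∂D))
            * ∫ S, Real.exp (t * (F (Fin.cons z S) - g z)) ∂P ∂D := by
          refine integral_congr_ae (ae_of_all _ fun z => ?_)
          simp only
          rw [← integral_const_mul]
          refine integral_congr_ae (ae_of_all _ fun S => ?_)
          simp only
          rw [← Real.exp_add, hEF]; congr 1; ring
      _ ≤ ∫ z, Real.exp (t * (g z - ∫ z', g z' ∂D))
            * Real.exp (n * (c / 2) ^ 2 * t ^ 2 / 2) ∂D := by
          refine integral_mono_of_nonneg (ae_of_all _ fun z => ?_)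
            ((hsub.integrable_exp_mul t).mul_const _) (ae_of_all _ fun z => ?_)
          · exact mul_nonneg (Real.exp_pos _).le (integral_nonneg fun _ => (Real.exp_pos _).le)
          · exact mul_le_mul_of_nonneg_left (hinner z) (Real.exp_pos _).le
      _ ≤ Real.exp ((c / 2) ^ 2 * t ^ 2 / 2) * Real.exp (n * (c / 2) ^ 2 * t ^ 2 / 2) := by
          rw [integral_mul_const]
          exact mul_le_mul_of_nonneg_right houter (Real.exp_pos _).le
      _ = _ := by
          rw [← Real.exp_add]; congr 1; push_cast; ring

/-- The bounded differences inequality of McDiarmid. -/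
theorem measure_abs_sub_integral_ge_le {n : ℕ} {F : (Fin n → Z) → ℝ} {B c : ℝ}
    (hF : Measurable F) (hB : ∀ S, |F S| ≤ B) (hd : ∀ S i z, |F (Function.update S i z) - F S| ≤ c)
    {ε : ℝ} (hε : 0 ≤ ε) :
    (Measure.pi fun _ => D) {S | ε ≤ |F S - ∫ S', F S' ∂(Measure.pi fun _ => D)|}
      ≤ ENNReal.ofReal (2 * Real.exp (-(2 * ε ^ 2 / (n * c ^ 2)))) := by
  set P : Measure (Fin n → Z) := Measure.pi fun _ => D with hP
  have hsub : ∀ F : (Fin n → Z) → ℝ, Measurable F → (∀ S, |F S| ≤ B) →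
      (∀ S i z, |F (Function.update S i z) - F S| ≤ c) →
      HasSubgaussianMGF (fun S => F S - ∫ S', F S' ∂P) (n * (c / 2) ^ 2).toNNReal P := by
    intro F hF hB hd
    have hbE : |∫ S, F S ∂P| ≤ B := by
      exact abs_integral_le_of_abs_le P hB
    refine ⟨fun t => ?_, fun t => ?_⟩
    · refine integrable_exp_mul_of_mem_Icc (a := -(2 * B)) (b := 2 * B) (by fun_prop)
        (ae_of_all _ fun S => ?_)
      have h1 := abs_le.1 (hB S)
      have h2 := abs_le.1 hbE
      exact ⟨by linarith, by linarith⟩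
    · rw [Real.coe_toNNReal _ (by positivity)]
      exact integral_exp_le_of_bounded_differences D hF hB hd t
  have hone : ∀ F : (Fin n → Z) → ℝ, Measurable F → (∀ S, |F S| ≤ B) →
      (∀ S i z, |F (Function.update S i z) - F S| ≤ c) →
      P {S | ε ≤ F S - ∫ S', F S' ∂P}
        ≤ ENNReal.ofReal (Real.exp (-(2 * ε ^ 2 / (n * c ^ 2)))) := by
    intro F hF hB hd
    have h := (hsub F hF hB hd).measure_ge_le hε
    rw [Real.coe_toNNReal _ (by positivity)] at h
    rw [← ENNReal.ofReal_toReal (measure_ne_top P _)]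
    refine ENNReal.ofReal_le_ofReal (h.trans_eq ?_)
    congr 1
    -- If n c² = 0, both quotients are 0 by the convention for division by zero, and both
    -- exponentials are 1.
    rcases eq_or_ne ((n : ℝ) * c ^ 2) 0 with h0 | h0
    · have : 2 * ((n : ℝ) * (c / 2) ^ 2) = 0 := by
        rw [div_pow, ← mul_div_assoc, h0]; simp
      rw [this, h0]; simp
    · have h1 : (n : ℝ) ≠ 0 := left_ne_zero_of_mul h0
      have h2 : c ≠ 0 := fun h => h0 (by simp [h])
      field_simp
  have hneg := hone (fun S => -F S) hF.neg (fun S => by rw [abs_neg]; exact hB S)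
    (fun S i z => by rw [← abs_neg]; simpa [sub_eq_add_neg, add_comm] using hd S i z)
  calc P {S | ε ≤ |F S - ∫ S', F S' ∂P|}
      ≤ P ({S | ε ≤ F S - ∫ S', F S' ∂P} ∪ {S | ε ≤ -F S - ∫ S', -F S' ∂P}) := by
        refine measure_mono fun S hS => ?_
        rcases le_abs.1 (show ε ≤ |F S - ∫ S', F S' ∂P| from hS) with h | h
        · exact Or.inl h
        · right
          simp only [Set.mem_ofPred_eq, integral_neg]
          linarith
    _ ≤ _ := measure_union_le _ _
    _ ≤ _ := add_le_add (hone F hF hB hd) hneg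
    _ = _ := by rw [← ENNReal.ofReal_add (Real.exp_pos _).le (Real.exp_pos _).le]; ring_nf

end BoundedDifferences

/-! ### Generalization of uniformly stable algorithms -/

section Stability

open ProbabilityTheory

variable {Z : Type*} [MeasurableSpace Z] (D : Measure Z) {m : ℕ}

/-- Expected minus empirical cost of the learning algorithm with cost function `c`. -/
noncomputable def generalizationGap (c : (Fin m → Z) → Z → ℝ) (S : Fin m → Z) : ℝ :=
  ∫ z, c S z ∂D - (m : ℝ)⁻¹ * ∑ i, c S (S i)

theorem generalizationGap_eq_sum (hm : 0 < m) (c : (Fin m → Z) → Z → ℝ) (S : Fin m → Z) :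
    generalizationGap D c S = (m : ℝ)⁻¹ * ∑ i, (∫ z, c S z ∂D - c S (S i)) := by
  have hm' : (m : ℝ) ≠ 0 := by exact_mod_cast hm.ne'
  rw [generalizationGap, Finset.sum_sub_distrib, mul_sub]
  simp [hm']

/-- A bounded, jointly measurable cost that changes by at most `β` when one training sample is
replaced. -/
structure UniformlyStable (c : (Fin m → Z) → Z → ℝ) (M β : ℝ) : Prop where
  measurable : Measurable (Function.uncurry c)
  nonneg : ∀ S z, 0 ≤ c S z
  le : ∀ S z, c S z ≤ M
  stable : ∀ S i w z, |c (Function.update S i w) z - c S z| ≤ β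

variable {c : (Fin m → Z) → Z → ℝ} {M β : ℝ}

theorem UniformlyStable.abs_cost_le (h : UniformlyStable c M β) (S : Fin m → Z) (z : Z) :
    |c S z| ≤ M := by
  rw [abs_of_nonneg (h.nonneg S z)]; exact h.le S z

variable [IsProbabilityMeasure D]

theorem UniformlyStable.integrable (h : UniformlyStable c M β) (S : Fin m → Z) :
    Integrable (c S) D :=
  Integrable.of_bound (h.measurable.comp measurable_prodMk_left).aestronglyMeasurable M
    (ae_of_all _ fun z => h.abs_cost_le S z)

theorem UniformlyStable.measurable_sample (h : UniformlyStable c M β) (i : Fin m) :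
    Measurable fun S => c S (S i) :=
  h.measurable.comp (measurable_id.prodMk (measurable_pi_apply i))

theorem UniformlyStable.measurable_risk (h : UniformlyStable c M β) :
    Measurable fun S => ∫ z, c S z ∂D :=
  (StronglyMeasurable.integral_prod_right h.measurable.stronglyMeasurable).measurable

theorem UniformlyStable.measurable_gap (h : UniformlyStable c M β) :
    Measurable (generalizationGap D c) :=
  (h.measurable_risk D).sub
    ((Finset.measurable_sum _ fun i _ => h.measurable_sample i).const_mul _)

theorem UniformlyStable.risk_mem (h : UniformlyStable c M β) (S : Fin m → Z) :
    0 ≤ ∫ z, c S z ∂D ∧ ∫ z, c S z ∂D ≤ M := by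
  refine ⟨integral_nonneg (h.nonneg S), ?_⟩
  simpa using integral_mono (h.integrable D S) (integrable_const M) (h.le S)

theorem UniformlyStable.abs_gap_le (h : UniformlyStable c M β) (hm : 0 < m) (S : Fin m → Z) :
    |generalizationGap D c S| ≤ M := by
  have hm' : (0 : ℝ) < m := by exact_mod_cast hm
  have h1 := h.risk_mem D S
  have h2 : 0 ≤ (m : ℝ)⁻¹ * ∑ i, c S (S i) :=
    mul_nonneg (by positivity) (Finset.sum_nonneg fun i _ => h.nonneg _ _)
  have h3 : (m : ℝ)⁻¹ * ∑ i, c S (S i) ≤ M := by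
    have : ∑ i, c S (S i) ≤ m * M := by
      simpa using Finset.sum_le_sum fun i (_ : i ∈ Finset.univ) => h.le S (S i)
    rw [inv_mul_le_iff₀ hm']; exact this
  rw [generalizationGap]
  exact abs_le.2 ⟨by linarith, by linarith⟩

/-- The expected cost contributes β, the samples kept contribute at most another β on average, and
the replaced sample contributes M / m. -/
theorem UniformlyStable.abs_gap_update_sub_le (h : UniformlyStable c M β) (hm : 0 < m)
    (S : Fin m → Z) (i : Fin m) (w : Z) :
    |generalizationGap D c (Function.update S i w) - generalizationGap D c S| ≤ 2 * β + M / m := by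
  have hm' : (0 : ℝ) < m := by exact_mod_cast hm
  have hβ : 0 ≤ β := (abs_nonneg _).trans (h.stable S i w w)
  have h1 : |∫ z, c (Function.update S i w) z ∂D - ∫ z, c S z ∂D| ≤ β := by
    rw [← integral_sub (h.integrable D _) (h.integrable D _)]
    exact abs_integral_le_of_abs_le D (h.stable S i w)
  have h2 : |∑ j, c (Function.update S i w) (Function.update S i w j) - ∑ j, c S (S j)|
      ≤ m * β + M := by
    rw [← Finset.sum_sub_distrib]
    refine (Finset.abs_sum_le_sum_abs _ _).trans ?_
    calc ∑ j, |c (Function.update S i w) (Function.update S i w j) - c S (S j)|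
        ≤ ∑ j, (β + if j = i then M else 0) := by
          refine Finset.sum_le_sum fun j _ => ?_
          by_cases hj : j = i
          · subst hj
            rw [Function.update_self, if_pos rfl, abs_le]
            have a1 := h.nonneg (Function.update S j w) w
            have a2 := h.le (Function.update S j w) w
            have a3 := h.nonneg S (S j)
            have a4 := h.le S (S j)
            constructor <;> linarith
          · rw [Function.update_of_ne hj, if_neg hj, add_zero]
            exact h.stable _ _ _ _
      _ = _ := by simp [Finset.sum_add_distrib]
  have h3 : |(m : ℝ)⁻¹ * (∑ j, c (Function.update S i w) (Function.update S i w j)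
      - ∑ j, c S (S j))| ≤ β + M / m := by
    rw [abs_mul, abs_of_pos (inv_pos.2 hm'), inv_mul_le_iff₀ hm']
    refine h2.trans_eq ?_
    field_simp
  simp only [generalizationGap]
  obtain ⟨a1, a2⟩ := abs_le.1 h1
  obtain ⟨b1, b2⟩ := abs_le.1 h3
  rw [mul_sub] at b1 b2
  exact abs_le.2 ⟨by linarith, by linarith⟩

/-- Comparison of the cost at a training sample with the expected cost, by resampling. -/
theorem UniformlyStable.abs_integral_mul_le (h : UniformlyStable c M β) {ψ : (Fin m → Z) → ℝ}
    {B K : ℝ} (hψ : Measurable ψ) (hB : ∀ S, |ψ S| ≤ B) (i : Fin m)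
    (hK : ∀ S z, |ψ S * c S z - ψ (Function.update S i z) * c (Function.update S i z) z| ≤ K) :
    |∫ S, ψ S * (∫ z, c S z ∂D - c S (S i)) ∂(Measure.pi fun _ => D)| ≤ K := by
  set P : Measure (Fin m → Z) := Measure.pi fun _ => D with hP
  have hbd : ∀ S S' z, ‖ψ S * c S' z‖ ≤ B * M := fun S S' z => by
    rw [norm_mul]
    exact mul_le_mul (hB S) (h.abs_cost_le S' z) (abs_nonneg _) ((abs_nonneg _).trans (hB S))
  have hm1 : Measurable fun p : (Fin m → Z) × Z => ψ p.1 * c p.1 p.2 :=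
    (hψ.comp measurable_fst).mul h.measurable
  have hm2 : Measurable fun S => ψ S * c S (S i) := hψ.mul (h.measurable_sample i)
  have hi1 : Integrable (fun p : (Fin m → Z) × Z => ψ p.1 * c p.1 p.2) (P.prod D) :=
    Integrable.of_bound hm1.aestronglyMeasurable _ (ae_of_all _ fun p => hbd _ _ _)
  have hi2 : Integrable (fun S => ψ S * c S (S i)) P :=
    Integrable.of_bound hm2.aestronglyMeasurable _ (ae_of_all _ fun p => hbd _ _ _)
  have hi3 : Integrable (fun S => ψ S * ∫ z, c S z ∂D) P := by
    refine Integrable.of_bound (hψ.mul (h.measurable_risk D)).aestronglyMeasurable (B * M)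
      (ae_of_all _ fun S => ?_)
    rw [norm_mul]
    refine mul_le_mul (hB S) ?_ (norm_nonneg _) ((abs_nonneg _).trans (hB S))
    rw [Real.norm_of_nonneg (h.risk_mem D S).1]
    exact (h.risk_mem D S).2
  have hmp := measurePreserving_update D i
  have e1 : ∫ S, ψ S * ∫ z, c S z ∂D ∂P = ∫ p, ψ p.1 * c p.1 p.2 ∂(P.prod D) := by
    rw [integral_prod _ hi1]
    simp only [integral_const_mul]
  -- Resampling coordinate i by z preserves the law and turns the i-th training point into z. Both
  -- integrals then evaluate the cost at the same point z, where `hK` compares them.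
  have e2 : ∫ S, ψ S * c S (S i) ∂P = ∫ p : (Fin m → Z) × Z,
      ψ (Function.update p.1 i p.2) * c (Function.update p.1 i p.2) p.2 ∂(P.prod D) := by
    rw [hP]
    nth_rewrite 1 [← hmp.map_eq]
    rw [integral_map hmp.measurable.aemeasurable hm2.aestronglyMeasurable]
    simp only [Function.update_self]
  have hi4 : Integrable (fun p : (Fin m → Z) × Z =>
      ψ (Function.update p.1 i p.2) * c (Function.update p.1 i p.2) p.2) (P.prod D) := by
    have := (hmp.integrable_comp hm2.aestronglyMeasurable).2 hi2
    simpa [Function.comp_def] using this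
  simp only [mul_sub]
  rw [integral_sub hi3 hi2, e1, e2, ← integral_sub hi1 hi4]
  exact abs_integral_le_of_abs_le (P.prod D) fun p => hK p.1 p.2

/-- The weight ψ lets one resampling argument serve both moments: ψ = 1 for the mean of the gap, ψ =
the gap itself for its second moment. -/
theorem UniformlyStable.abs_integral_mul_gap_le (h : UniformlyStable c M β) (hm : 0 < m)
    {ψ : (Fin m → Z) → ℝ} {B K : ℝ} (hψ : Measurable ψ) (hB : ∀ S, |ψ S| ≤ B)
    (hK : ∀ S i z, |ψ S * c S z - ψ (Function.update S i z) * c (Function.update S i z) z| ≤ K) :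
    |∫ S, ψ S * generalizationGap D c S ∂(Measure.pi fun _ => D)| ≤ K := by
  have hm' : (0 : ℝ) < m := by exact_mod_cast hm
  set P : Measure (Fin m → Z) := Measure.pi fun _ => D with hP
  have hi : ∀ i, Integrable (fun S => ψ S * (∫ z, c S z ∂D - c S (S i))) P := fun i => by
    refine Integrable.of_bound (hψ.mul ((h.measurable_risk D).sub
      (h.measurable_sample i))).aestronglyMeasurable (B * M) (ae_of_all _ fun S => ?_)
    rw [norm_mul]
    refine mul_le_mul (hB S) ?_ (norm_nonneg _) ((abs_nonneg _).trans (hB S))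
    have h1 := h.risk_mem D S
    have h2 := h.nonneg S (S i)
    have h3 := h.le S (S i)
    exact abs_le.2 ⟨by linarith, by linarith⟩
  have e : ∫ S, ψ S * generalizationGap D c S ∂P
      = (m : ℝ)⁻¹ * ∑ i, ∫ S, ψ S * (∫ z, c S z ∂D - c S (S i)) ∂P := by
    rw [← integral_finsetSum _ fun i _ => hi i, ← integral_const_mul]
    refine integral_congr_ae (ae_of_all _ fun S => ?_)
    simp only
    rw [generalizationGap_eq_sum D hm, ← Finset.mul_sum]; ring
  rw [e, abs_mul, abs_of_pos (inv_pos.2 hm'), inv_mul_le_iff₀ hm']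
  refine (Finset.abs_sum_le_sum_abs _ _).trans ?_
  refine (Finset.sum_le_sum fun i _ =>
    h.abs_integral_mul_le D hψ hB i fun S z => hK S i z).trans_eq ?_
  simp

theorem UniformlyStable.abs_integral_gap_le (h : UniformlyStable c M β) (hm : 0 < m) :
    |∫ S, generalizationGap D c S ∂(Measure.pi fun _ => D)| ≤ β := by
  have := h.abs_integral_mul_gap_le D hm (ψ := fun _ => 1) (B := 1) (K := β) measurable_const
    (by simp) (fun S i z => by
      rw [one_mul, one_mul, abs_sub_comm]; exact h.stable S i z z)
  simpa using this

theorem UniformlyStable.integral_gap_sq_le (h : UniformlyStable c M β) (hm : 0 < m) :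
    ∫ S, generalizationGap D c S ^ 2 ∂(Measure.pi fun _ => D) ≤ 3 * M * β + M ^ 2 / m := by
  have hK := h.abs_integral_mul_gap_le D hm (ψ := generalizationGap D c)
    (K := 3 * M * β + M ^ 2 / m) (h.measurable_gap D) (h.abs_gap_le D hm) (fun S i z => by
      have hM : 0 ≤ M := (h.nonneg S z).trans (h.le S z)
      have h1 := h.abs_gap_update_sub_le D hm S i z
      have h2 := h.stable S i z z
      have h3 := h.abs_gap_le D hm S
      have h4 := h.abs_cost_le (Function.update S i z) z
      set a := generalizationGap D c S
      set a' := generalizationGap D c (Function.update S i z)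
      set d := c S z
      set d' := c (Function.update S i z) z
      -- The change of the cost gives Mβ and the change of the gap gives (2β + M/m)M; their sum is
      -- K.
      have e : a * d - a' * d' = -(a * (d' - d)) - (a' - a) * d' := by ring
      rw [e]
      calc |-(a * (d' - d)) - (a' - a) * d'| ≤ |a| * |d' - d| + |a' - a| * |d'| := by
            refine (abs_sub _ _).trans_eq ?_
            rw [abs_neg, abs_mul, abs_mul]
        _ ≤ M * β + (2 * β + M / m) * M := by
            have := (abs_nonneg _).trans h1
            gcongr
        _ = _ := by ring)
  refine le_trans ?_ ((le_abs_self _).trans hK)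
  simp only [sq, le_refl]

theorem UniformlyStable.measure_gap_gt_le (h : UniformlyStable c M β) (hm : 0 < m) {ε : ℝ}
    (hε : 0 < ε) :
    (Measure.pi fun _ => D) {S | ε < |generalizationGap D c S|}
      ≤ ENNReal.ofReal ((3 * M * β + M ^ 2 / m) / ε ^ 2) := by
  set P : Measure (Fin m → Z) := Measure.pi fun _ => D with hP
  have hi : Integrable (fun S => generalizationGap D c S ^ 2) P := by
    refine Integrable.of_bound ((h.measurable_gap D).pow_const 2).aestronglyMeasurable (M ^ 2)
      (ae_of_all _ fun S => ?_)
    rw [norm_pow]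
    exact pow_le_pow_left₀ (norm_nonneg _) (h.abs_gap_le D hm S) 2
  have hmarkov := mul_meas_ge_le_integral_of_nonneg (μ := P)
    (ae_of_all _ fun S => sq_nonneg (generalizationGap D c S)) hi (ε ^ 2)
  have h1 : P.real {S | ε ^ 2 ≤ generalizationGap D c S ^ 2} ≤ (3 * M * β + M ^ 2 / m) / ε ^ 2 := by
    rw [le_div_iff₀ (by positivity), mul_comm]
    exact hmarkov.trans (h.integral_gap_sq_le D hm)
  calc P {S | ε < |generalizationGap D c S|}
      ≤ P {S | ε ^ 2 ≤ generalizationGap D c S ^ 2} := by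
        refine measure_mono fun S hS => ?_
        rw [Set.mem_ofPred_eq] at hS ⊢
        rw [← sq_abs (generalizationGap D c S)]
        exact pow_le_pow_left₀ hε.le hS.le 2
    _ = ENNReal.ofReal (P.real {S | ε ^ 2 ≤ generalizationGap D c S ^ 2}) :=
        (ENNReal.ofReal_toReal (measure_ne_top P _)).symm
    _ ≤ _ := ENNReal.ofReal_le_ofReal h1

theorem UniformlyStable.measure_gap_gt_add_le (h : UniformlyStable c M β) (hm : 0 < m) {ε : ℝ}
    (hε : 0 < ε) :
    (Measure.pi fun _ => D) {S | ε + β < |generalizationGap D c S|}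
      ≤ ENNReal.ofReal (2 * Real.exp (-(2 * ε ^ 2 / (m * (2 * β + M / m) ^ 2)))) := by
  refine le_trans (measure_mono fun S hS => ?_)
    (measure_abs_sub_integral_ge_le D (h.measurable_gap D) (h.abs_gap_le D hm)
      (h.abs_gap_update_sub_le D hm) hε.le)
  rw [Set.mem_ofPred_eq] at hS ⊢
  have h1 := h.abs_integral_gap_le D hm
  have h2 := abs_sub_abs_le_abs_sub (generalizationGap D c S)
    (∫ S', generalizationGap D c S' ∂(Measure.pi fun _ => D))
  linarith

end Stability

/-! ### Label counts and label sums at the vertices -/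

section Scatter

open Matrix Finset

variable {V : Type*} [DecidableEq V]

/-- The vertex function that adds up the values `y i` at the vertices `v i`. -/
noncomputable def scatter {ι : Type*} (s : Finset ι) (v : ι → V) (y : ι → ℝ) : V → ℝ :=
  ∑ i ∈ s, Pi.single (v i) (y i)

variable {ι : Type*} {s : Finset ι} {v : ι → V}

theorem scatter_mono {y y' : ι → ℝ} (h : ∀ i ∈ s, y i ≤ y' i) (u : V) :
    scatter s v y u ≤ scatter s v y' u := by
  simp only [scatter, Finset.sum_apply]
  refine sum_le_sum fun i hi => ?_
  by_cases hu : u = v i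
  · subst hu; simpa using h i hi
  · simp [hu]

theorem scatter_smul (a : ℝ) (y : ι → ℝ) (u : V) :
    scatter s v (fun i => a * y i) u = a * scatter s v y u := by
  simp only [scatter, Finset.sum_apply, mul_sum]
  refine sum_congr rfl fun i _ => ?_
  by_cases hu : u = v i
  · subst hu; simp
  · simp [hu]

theorem scatter_one_nonneg (u : V) : 0 ≤ scatter s v 1 u := by
  have h := scatter_mono (s := s) (v := v) (y := 0) (y' := 1) (fun _ _ => zero_le_one) u
  simpa [scatter] using h

theorem scatter_one_pos (hs : s.Nonempty) : ∃ u, 0 < scatter s v 1 u := by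
  obtain ⟨i, hi⟩ := hs
  refine ⟨v i, ?_⟩
  simp only [scatter, Finset.sum_apply]
  refine sum_pos' (fun j _ => ?_) ⟨i, hi, by simp⟩
  by_cases h : v i = v j
  · simp [h]
  · simp [h]

theorem abs_scatter_le {y : ι → ℝ} {a : ℝ} (hy : ∀ i ∈ s, |y i| ≤ a) (u : V) :
    |scatter s v y u| ≤ scatter s v 1 u * a := by
  have h1 := scatter_mono (s := s) (v := v) (y := y) (y' := fun i => a * (1 : ι → ℝ) i)
    (fun i hi => by simpa using (abs_le.1 (hy i hi)).2) u
  have h2 := scatter_mono (s := s) (v := v) (y := fun i => -a * (1 : ι → ℝ) i) (y' := y)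
    (fun i hi => by simpa using (abs_le.1 (hy i hi)).1) u
  rw [scatter_smul] at h1 h2
  exact abs_le.2 ⟨by linarith, by linarith⟩

variable [Fintype V]

theorem sum_scatter_one : ∑ u, scatter s v 1 u = s.card := by
  simp only [scatter, Finset.sum_apply]
  rw [sum_comm]
  simp

theorem dotProduct_scatter (x : V → ℝ) (y : ι → ℝ) :
    x ⬝ᵥ scatter s v y = ∑ i ∈ s, x (v i) * y i := by
  simp only [scatter, dotProduct_sum, dotProduct_single]

end Scatter

/-! ### Scalar label propagation and its stability -/

section Propagation

open Matrix Finset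

variable {V : Type*} [Fintype V]

/-- The scalar Tikhonov objective. -/
noncomputable def WeightedGraph.scalarObjective (G : WeightedGraph V) (γ : ℝ) {m : ℕ}
    (v : Fin m → V) (y : Fin m → ℝ) (x : V → ℝ) : ℝ :=
  (m : ℝ)⁻¹ * ∑ i, (x (v i) - y i) ^ 2
    + γ * (2⁻¹ * ∑ i, ∑ j, G.weight i j * (x i - x j) ^ 2)

theorem WeightedGraph.scalarObjective_nonneg (G : WeightedGraph V) {γ : ℝ} (hγ : 0 ≤ γ) {m : ℕ}
    (v : Fin m → V) (y : Fin m → ℝ) (x : V → ℝ) : 0 ≤ G.scalarObjective γ v y x :=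
  add_nonneg (mul_nonneg (by positivity) (sum_nonneg fun _ _ => sq_nonneg _))
    (mul_nonneg hγ (mul_nonneg (by norm_num) (sum_nonneg fun i _ => sum_nonneg fun j _ =>
      mul_nonneg (G.weight_nonneg i j) (sq_nonneg _))))

variable [DecidableEq V] (G : WeightedGraph V)

/-- Scalar label propagation: the solution of `(n + c L) x = b`, where `n` counts the labels and
`b` adds up the labels at each vertex. -/
noncomputable def WeightedGraph.propagate (c : ℝ) {ι : Type*} (s : Finset ι) (v : ι → V)
    (y : ι → ℝ) : V → ℝ :=
  (G.screened c (scatter s v 1))⁻¹ *ᵥ scatter s v y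

variable {G} {c : ℝ} {ι : Type*} {s : Finset ι} {v : ι → V}

theorem WeightedGraph.screened_propagate (hG : G.graph.Connected) (hc : 0 < c) (hs : s.Nonempty)
    (y : ι → ℝ) :
    G.screened c (scatter s v 1) *ᵥ G.propagate c s v y = scatter s v y :=
  G.screened_mulVec_inv hG hc scatter_one_nonneg (scatter_one_pos hs) _

theorem WeightedGraph.abs_propagate_le (hG : G.graph.Connected) (hc : 0 < c) (hs : s.Nonempty)
    {y : ι → ℝ} {a : ℝ} (hy : ∀ i ∈ s, |y i| ≤ a) (u : V) : |G.propagate c s v y u| ≤ a :=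
  G.abs_le_of_screened hG hc scatter_one_nonneg (scatter_one_pos hs)
    (G.screened_propagate hG hc hs y) (abs_scatter_le hy) u

/-- By the minimum principle the inverse operator preserves order. This is what keeps propagated
quantile functions monotone in the level. -/
theorem WeightedGraph.propagate_mono (hG : G.graph.Connected) (hc : 0 < c) (hs : s.Nonempty)
    {y y' : ι → ℝ} (h : ∀ i ∈ s, y i ≤ y' i) (u : V) :
    G.propagate c s v y u ≤ G.propagate c s v y' u := by
  have := G.nonneg_of_screened hG hc scatter_one_nonneg (scatter_one_pos hs)
    (w := G.propagate c s v y' - G.propagate c s v y) (fun i _ => by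
      rw [mulVec_sub, G.screened_propagate hG hc hs, G.screened_propagate hG hc hs, Pi.sub_apply,
        sub_nonneg]
      exact scatter_mono h i) u
  simpa using this

theorem WeightedGraph.propagate_eq_sum (y : ι → ℝ) (u : V) :
    G.propagate c s v y u = ∑ i ∈ s, (G.screened c (scatter s v 1))⁻¹ u (v i) * y i :=
  dotProduct_scatter _ _

/-- Adding one label to a nonempty label set. -/
theorem WeightedGraph.abs_propagate_sub_le [DecidableEq ι] (hG : G.graph.Connected) (hc : 0 < c)
    {l : ℝ} (hl0 : 0 < l) (hl : G.IsSpectralGap l) {i : ι} (hi : i ∈ s)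
    (hs : (s.erase i).Nonempty) {y : ι → ℝ} {a : ℝ} (hy : ∀ j ∈ s, |y j| ≤ a) (u : V) :
    |G.propagate c s v y u - (1 - (1 / (s.card : ℝ) + 2 / (c * l)))
        * G.propagate c (s.erase i) v y u| ≤ (1 / (s.card : ℝ) + 2 / (c * l)) * a := by
  have hs' : s.Nonempty := ⟨i, hi⟩
  have hsplit : ∀ z : ι → ℝ, scatter s v z = scatter (s.erase i) v z + Pi.single (v i) (z i) :=
    fun z => by rw [scatter, ← add_sum_erase _ _ hi, add_comm]; rfl
  have hx := G.screened_propagate hG hc hs' (v := v) y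
  have hk := G.screened_mulVec_inv hG hc (scatter_one_nonneg (s := s) (v := v))
    (scatter_one_pos hs') (Pi.single (v i) 1)
  have hκ := G.green_diag_le hG hc (scatter_one_nonneg (s := s) (v := v)) hl0 hl
    (by exact_mod_cast card_pos.2 hs') sum_scatter_one hk
  rw [hsplit y, hsplit 1] at hx
  rw [hsplit 1] at hk hκ
  exact G.abs_sub_le_of_add_label hG hc scatter_one_nonneg (scatter_one_pos hs)
    (G.screened_propagate hG hc hs y)
    (abs_scatter_le fun j hj => hy j (mem_of_mem_erase hj)) (hy i hi) hx hk hκ u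

/-- Stability of label propagation under replacement of one label. -/
theorem WeightedGraph.abs_propagate_sub_propagate_le [DecidableEq ι] (hG : G.graph.Connected)
    (hc : 0 < c) {l : ℝ} (hl0 : 0 < l) (hl : G.IsSpectralGap l) {i : ι} (hi : i ∈ s)
    (hs : (s.erase i).Nonempty) {y y' : ι → ℝ} {v' : ι → V} {a : ℝ} (hy : ∀ j ∈ s, |y j| ≤ a)
    (hy' : ∀ j ∈ s, |y' j| ≤ a) (hyy : ∀ j ∈ s, j ≠ i → y j = y' j)
    (hvv : ∀ j ∈ s, j ≠ i → v j = v' j) (u : V) :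
    |G.propagate c s v y u - G.propagate c s v' y' u|
      ≤ 2 * (1 / (s.card : ℝ) + 2 / (c * l)) * a := by
  have hsc : ∀ z z' : ι → ℝ, (∀ j ∈ s, j ≠ i → z j = z' j) →
      scatter (s.erase i) v z = scatter (s.erase i) v' z' := fun z z' h =>
    sum_congr rfl fun j hj => by
      rw [h j (mem_of_mem_erase hj) (ne_of_mem_erase hj),
        hvv j (mem_of_mem_erase hj) (ne_of_mem_erase hj)]
  -- With label i deleted, both problems coincide; each full solution is within κ a of the same
  -- multiple of this solution, whence the factor 2.
  have h0 : G.propagate c (s.erase i) v y = G.propagate c (s.erase i) v' y' := by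
    rw [WeightedGraph.propagate, WeightedGraph.propagate, hsc y y' hyy,
      hsc 1 1 fun _ _ _ => rfl]
  have h1 := G.abs_propagate_sub_le hG hc hl0 hl hi hs hy (v := v) u
  have h2 := G.abs_propagate_sub_le hG hc hl0 hl hi hs hy' (v := v') u
  rw [h0] at h1
  obtain ⟨a1, a2⟩ := abs_le.1 h1
  obtain ⟨b1, b2⟩ := abs_le.1 h2
  exact abs_le.2 ⟨by linarith, by linarith⟩

theorem WeightedGraph.mul_scalarObjective {γ : ℝ} {m : ℕ} (hm : 0 < m) (v : Fin m → V)
    (y : Fin m → ℝ) (x : V → ℝ) :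
    m * G.scalarObjective γ v y x = x ⬝ᵥ (G.screened (m * γ) (scatter univ v 1) *ᵥ x)
      - 2 * (x ⬝ᵥ scatter univ v y) + ∑ i, y i ^ 2 := by
  have hm' : (m : ℝ) ≠ 0 := by exact_mod_cast hm.ne'
  have h1 : ∑ u, scatter univ v 1 u * (x u * x u) = ∑ i, x (v i) ^ 2 := by
    have := dotProduct_scatter (s := univ) (v := v) (fun u => x u * x u) 1
    rw [dotProduct_comm] at this
    simpa [dotProduct, sq] using this
  rw [G.dotProduct_screened, h1, dotProduct_scatter, G.dotProduct_laplacian,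
    WeightedGraph.scalarObjective]
  have h2 : ∀ i, (x (v i) - y i) ^ 2 = x (v i) ^ 2 - 2 * (x (v i) * y i) + y i ^ 2 :=
    fun i => by ring
  simp only [h2, sum_add_distrib, sum_sub_distrib, ← mul_sum, ← sq]
  rw [mul_add, mul_inv_cancel_left₀ hm']
  ring

/-- The scalar objective is minimal at the propagated labels, with quadratic growth. -/
theorem WeightedGraph.scalarObjective_eq_add {γ : ℝ} {m : ℕ} (hG : G.graph.Connected)
    (hγ : 0 < γ) (hm : 0 < m) (v : Fin m → V) (y : Fin m → ℝ) (x : V → ℝ) :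
    G.scalarObjective γ v y x
      = G.scalarObjective γ v y (G.propagate (m * γ) univ v y)
        + (m : ℝ)⁻¹ * ((x - G.propagate (m * γ) univ v y) ⬝ᵥ
          (G.screened (m * γ) (scatter univ v 1) *ᵥ (x - G.propagate (m * γ) univ v y))) := by
  have hm' : (0 : ℝ) < m := by exact_mod_cast hm
  have : Nonempty (Fin m) := ⟨⟨0, hm⟩⟩
  have hsol := G.screened_propagate hG (mul_pos hm' hγ) univ_nonempty (v := v) y
  set x₀ := G.propagate (m * γ) univ v y
  refine mul_left_cancel₀ hm'.ne' ?_
  rw [mul_add, mul_inv_cancel_left₀ hm'.ne', G.mul_scalarObjective hm, G.mul_scalarObjective hm]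
  have hsymm : x₀ ⬝ᵥ (G.screened (m * γ) (scatter univ v 1) *ᵥ x)
      = x ⬝ᵥ (G.screened (m * γ) (scatter univ v 1) *ᵥ x₀) := by
    simp only [G.dotProduct_screened, G.dotProduct_laplacian]
    simp only [mul_comm (x₀ _), mul_comm (x₀ _ - x₀ _)]
  rw [mulVec_sub, sub_dotProduct, dotProduct_sub, dotProduct_sub, hsymm, hsol]
  ring

end Propagation

/-! ### Minimizers are propagated quantile functions -/

section Minimizer

open Finset

variable {V : Type*} [Fintype V] {G : WeightedGraph V}

theorem edist_sq_eq_ofReal (x y : ℝ) : edist x y ^ 2 = ENNReal.ofReal ((x - y) ^ 2) := by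
  rw [edist_dist, Real.dist_eq, ← ENNReal.ofReal_pow (abs_nonneg _), sq_abs]

theorem W2sq_eq_lintegral_sq (μ ν : ProbabilityMeasure ℝ) :
    W2sq μ ν = ∫⁻ s, ENNReal.ofReal ((quantile μ s - quantile ν s) ^ 2) ∂unif := by
  simp only [W2sq_eq_lintegral_quantile, edist_sq_eq_ofReal]

theorem aemeasurable_quantile_sub_sq (μ ν : ProbabilityMeasure ℝ) :
    AEMeasurable (fun s => ENNReal.ofReal ((quantile μ s - quantile ν s) ^ 2)) unif :=
  (((aemeasurable_quantile μ).sub (aemeasurable_quantile ν)).pow_const 2).ennreal_ofReal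

/-- The graph objective is the integral over the levels of the scalar objectives of the
quantiles. -/
theorem graphObjective_eq_lintegral {γ : ℝ} (hγ : 0 ≤ γ) {m : ℕ} (hm : 0 < m)
    (S : Fin m → V × ProbabilityMeasure ℝ) (f : V → ProbabilityMeasure ℝ) :
    graphObjective G γ S f = ∫⁻ s, ENNReal.ofReal (G.scalarObjective γ (fun i => (S i).1)
      (fun i => quantile (S i).2 s) (fun u => quantile (f u) s)) ∂unif := by
  have hm' : (0 : ℝ) < m := by exact_mod_cast hm
  have hw := G.weight_nonneg
  have hpt : ∀ s, ENNReal.ofReal (G.scalarObjective γ (fun i => (S i).1)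
      (fun i => quantile (S i).2 s) (fun u => quantile (f u) s))
      = (m : ℝ≥0∞)⁻¹ * ∑ i, ENNReal.ofReal ((quantile (f (S i).1) s - quantile (S i).2 s) ^ 2)
        + ENNReal.ofReal γ * (2⁻¹ * ∑ i, ∑ j, ENNReal.ofReal (G.weight i j)
          * ENNReal.ofReal ((quantile (f i) s - quantile (f j) s) ^ 2)) := by
    intro s
    have hnn : ∀ i j, 0 ≤ G.weight i j * (quantile (f i) s - quantile (f j) s) ^ 2 := fun i j =>
      mul_nonneg (hw i j) (sq_nonneg _)
    rw [WeightedGraph.scalarObjective, ENNReal.ofReal_add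
      (mul_nonneg (by positivity) (sum_nonneg fun _ _ => sq_nonneg _))
      (mul_nonneg hγ (mul_nonneg (by norm_num) (sum_nonneg fun i _ => sum_nonneg fun j _ =>
        hnn i j))), ENNReal.ofReal_mul (by positivity), ENNReal.ofReal_inv_of_pos hm',
      ENNReal.ofReal_natCast, ENNReal.ofReal_sum_of_nonneg (fun _ _ => sq_nonneg _),
      ENNReal.ofReal_mul hγ, ENNReal.ofReal_mul (by norm_num), ENNReal.ofReal_inv_of_pos two_pos,
      ENNReal.ofReal_ofNat,
      ENNReal.ofReal_sum_of_nonneg (fun i _ => sum_nonneg fun j _ => hnn i j)]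
    simp only [ENNReal.ofReal_sum_of_nonneg (fun j _ => hnn _ j), ENNReal.ofReal_mul (hw _ _)]
  have hA := fun i : Fin m => aemeasurable_quantile_sub_sq (f (S i).1) (S i).2
  have hB := fun i j : V =>
    (aemeasurable_quantile_sub_sq (f i) (f j)).const_mul (ENNReal.ofReal (G.weight i j))
  have hBi := fun i : V => Finset.aemeasurable_fun_sum univ fun j _ => hB i j
  simp only [hpt]
  rw [lintegral_add_left' ((Finset.aemeasurable_fun_sum _ fun i _ => hA i).const_mul _),
    lintegral_const_mul'' _ (Finset.aemeasurable_fun_sum _ fun i _ => hA i),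
    lintegral_finsetSum' _ fun i _ => hA i,
    lintegral_const_mul'' _ ((Finset.aemeasurable_fun_sum _ fun i _ => hBi i).const_mul _),
    lintegral_const_mul'' _ (Finset.aemeasurable_fun_sum _ fun i _ => hBi i),
    lintegral_finsetSum' _ fun i _ => hBi i]
  simp only [lintegral_finsetSum' _ fun j _ => hB _ j,
    lintegral_const_mul'' _ (aemeasurable_quantile_sub_sq _ _)]
  simp only [graphObjective, empiricalRisk, W2sq_eq_lintegral_sq]

/-- The quantile functions of a minimizer are the propagated quantile functions of the labels. -/
theorem quantile_minimizer_ae_eq [DecidableEq V] {γ : ℝ} (hG : G.graph.Connected) (hγ : 0 < γ) {m : ℕ} (hm : 0 < m)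
    {S : Fin m → V × ProbabilityMeasure ℝ}
    (hS : ∀ i, ∫⁻ s, ENNReal.ofReal (quantile (S i).2 s ^ 2) ∂unif ≠ ∞)
    {f : V → ProbabilityMeasure ℝ} (hf : ∀ g, graphObjective G γ S f ≤ graphObjective G γ S g) :
    ∀ᵐ s ∂unif, ∀ u, quantile (f u) s = G.propagate (m * γ) univ (fun i => (S i).1)
      (fun i => quantile (S i).2 s) u := by
  have hm' : (0 : ℝ) < m := by exact_mod_cast hm
  have : Nonempty (Fin m) := ⟨⟨0, hm⟩⟩
  have hc : 0 < m * γ := mul_pos hm' hγ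
  set v : Fin m → V := fun i => (S i).1 with hv
  set x : ℝ → V → ℝ := fun s => G.propagate (m * γ) univ v fun i => quantile (S i).2 s with hx
  have hmono : ∀ u, MonotoneOn (fun s => x s u) (Set.Ioo 0 1) := fun u s hs t ht hst =>
    G.propagate_mono hG hc univ_nonempty (fun i _ => monotoneOn_quantile _ hs ht hst) u
  -- The levelwise minimizer is monotone in the level, hence realized by measures g; it is a
  -- legitimate competitor for f.
  choose g hg using fun u => exists_quantile_ae_eq (hmono u)
  have hg' : ∀ᵐ s ∂unif, ∀ u, quantile (g u) s = x s u := ae_all_iff.2 hg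
  set J := fun (s : ℝ) (z : V → ℝ) => G.scalarObjective γ v (fun i => quantile (S i).2 s) z with hJ
  set E := fun s => (m : ℝ)⁻¹ * (((fun u => quantile (f u) s) - x s) ⬝ᵥ
    (G.screened (m * γ) (scatter univ v 1)).mulVec ((fun u => quantile (f u) s) - x s)) with hE
  have hEnn : ∀ s, 0 ≤ E s := fun s => by
    refine mul_nonneg (by positivity) ?_
    rw [G.dotProduct_screened]
    exact add_nonneg (sum_nonneg fun u _ => mul_nonneg (scatter_one_nonneg u) (mul_self_nonneg _))
      (mul_nonneg hc.le (G.dotProduct_laplacian_self_nonneg _))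
  have hobjg : graphObjective G γ S g = ∫⁻ s, ENNReal.ofReal (J s (x s)) ∂unif := by
    rw [graphObjective_eq_lintegral hγ.le hm]
    refine lintegral_congr_ae ?_
    filter_upwards [hg'] with s hs
    simp only [hs]
    rfl
  have hxm : ∀ u, AEMeasurable (fun s => x s u) unif := fun u =>
    aemeasurable_restrict_of_monotoneOn measurableSet_Ioo (hmono u)
  have hJm : AEMeasurable (fun s => ENNReal.ofReal (J s (x s))) unif := by
    refine AEMeasurable.ennreal_ofReal ?_
    simp only [hJ, WeightedGraph.scalarObjective]
    refine ((Finset.aemeasurable_fun_sum _ fun i _ =>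
      ((hxm _).sub (aemeasurable_quantile _)).pow_const 2).const_mul _).add
      (((Finset.aemeasurable_fun_sum _ fun i _ => Finset.aemeasurable_fun_sum _ fun j _ =>
        (((hxm i).sub (hxm j)).pow_const 2).const_mul _).const_mul _).const_mul _)
  have hobjf : graphObjective G γ S f
      = ∫⁻ s, ENNReal.ofReal (J s (x s)) ∂unif + ∫⁻ s, ENNReal.ofReal (E s) ∂unif := by
    rw [graphObjective_eq_lintegral hγ.le hm, ← lintegral_add_left' hJm]
    refine lintegral_congr fun s => ?_
    rw [← ENNReal.ofReal_add (G.scalarObjective_nonneg hγ.le _ _ _) (hEnn s)]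
    congr 1
    exact G.scalarObjective_eq_add hG hγ hm v (fun i => quantile (S i).2 s) _
  -- Finiteness is needed to cancel the minimal value in `ℝ≥0∞`; comparison with the zero function
  -- bounds it by the second moments of the labels.
  have hfin : ∫⁻ s, ENNReal.ofReal (J s (x s)) ∂unif ≠ ∞ := by
    have hle : ∀ s, ENNReal.ofReal (J s (x s)) ≤
        ∑ i, ENNReal.ofReal (quantile (S i).2 s ^ 2) := fun s => by
      rw [← ENNReal.ofReal_sum_of_nonneg fun _ _ => sq_nonneg _]
      refine ENNReal.ofReal_le_ofReal ?_
      have h1 := G.scalarObjective_eq_add hG hγ hm v (fun i => quantile (S i).2 s) 0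
      have h2 : G.scalarObjective γ v (fun i => quantile (S i).2 s) 0
          ≤ ∑ i, quantile (S i).2 s ^ 2 := by
        have h3 : (m : ℝ)⁻¹ ≤ 1 := inv_le_one_of_one_le₀ (by exact_mod_cast hm)
        have h4 : 0 ≤ ∑ i, quantile (S i).2 s ^ 2 := sum_nonneg fun _ _ => sq_nonneg _
        simp only [WeightedGraph.scalarObjective]
        simpa using mul_le_of_le_one_left h4 h3
      have h5 : 0 ≤ (m : ℝ)⁻¹ * ((0 - x s) ⬝ᵥ
          (G.screened (m * γ) (scatter univ v 1)).mulVec (0 - x s)) := by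
        refine mul_nonneg (by positivity) ?_
        rw [G.dotProduct_screened]
        exact add_nonneg (sum_nonneg fun u _ => mul_nonneg (scatter_one_nonneg u)
          (mul_self_nonneg _)) (mul_nonneg hc.le (G.dotProduct_laplacian_self_nonneg _))
      simp only [hJ]
      linarith
    refine ne_top_of_le_ne_top ?_ (lintegral_mono hle)
    rw [lintegral_finsetSum' _ fun i _ =>
      ((aemeasurable_quantile _).pow_const 2).ennreal_ofReal]
    exact ENNReal.sum_ne_top.2 fun i _ => hS i
  have hE0 : ∫⁻ s, ENNReal.ofReal (E s) ∂unif = 0 := by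
    have h := hf g
    rw [hobjf, hobjg] at h
    have h' : ∫⁻ s, ENNReal.ofReal (J s (x s)) ∂unif + ∫⁻ s, ENNReal.ofReal (E s) ∂unif
        ≤ ∫⁻ s, ENNReal.ofReal (J s (x s)) ∂unif + 0 := by rwa [add_zero]
    exact le_antisymm ((ENNReal.add_le_add_iff_left hfin).1 h') (zero_le)
  have hEm : AEMeasurable (fun s => ENNReal.ofReal (E s)) unif := by
    refine AEMeasurable.ennreal_ofReal ?_
    have hd : ∀ u, AEMeasurable (fun s => quantile (f u) s - x s u) unif := fun u =>
      (aemeasurable_quantile _).sub (hxm u)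
    simp only [hE, dotProduct, Matrix.mulVec, Pi.sub_apply]
    exact (Finset.aemeasurable_fun_sum _ fun u _ => (hd u).mul
      (Finset.aemeasurable_fun_sum _ fun w _ => (hd w).const_mul _)).const_mul _
  rw [lintegral_eq_zero_iff' hEm] at hE0
  filter_upwards [hE0] with s hs u
  have h0 : E s ≤ 0 := ENNReal.ofReal_eq_zero.1 hs
  have h1 : ((fun u => quantile (f u) s) - x s) ⬝ᵥ
      (G.screened (m * γ) (scatter univ v 1)).mulVec ((fun u => quantile (f u) s) - x s) ≤ 0 := by
    by_contra! hpos
    exact absurd h0 (not_le.2 (mul_pos (inv_pos.2 hm') hpos))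
  have h2 := G.eq_zero_of_screened_energy_nonpos hG hc scatter_one_nonneg
    (scatter_one_pos univ_nonempty) h1
  exact sub_eq_zero.1 (congrFun h2 u)

end Minimizer

/-! ### Reduction of the hypergraph to its clique graph -/

section Hypergraph

open Finset

variable {V : Type*}

theorem W2sq_self (μ : ProbabilityMeasure ℝ) : W2sq μ μ = 0 := by
  simp [W2sq_eq_lintegral_quantile]

/-- Variance plus squared bias, with the variance expressed through pairwise differences. Only the
bias depends on t, so the optimal t is the mean; the factor 1/|E|² becomes the clique weight. -/
theorem sum_sub_sq_eq (E : Finset V) (hE : E.Nonempty) (a : V → ℝ) (t : ℝ) :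
    (E.card : ℝ)⁻¹ * ∑ i ∈ E, (a i - t) ^ 2
      = 1 / (E.card : ℝ) ^ 2 * (2⁻¹ * ∑ i ∈ E, ∑ j ∈ E, (a i - a j) ^ 2)
        + ((E.card : ℝ)⁻¹ * ∑ i ∈ E, a i - t) ^ 2 := by
  have hk : (E.card : ℝ) ≠ 0 := by exact_mod_cast (card_pos.2 hE).ne'
  have h1 : ∑ i ∈ E, (a i - t) ^ 2
      = ∑ i ∈ E, a i ^ 2 - 2 * t * ∑ i ∈ E, a i + E.card * t ^ 2 := by
    rw [mul_sum, ← sum_sub_distrib, ← nsmul_eq_mul, ← sum_const, ← sum_add_distrib]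
    exact sum_congr rfl fun i _ => by ring
  have h2 : ∑ i ∈ E, ∑ j ∈ E, (a i - a j) ^ 2
      = 2 * E.card * ∑ i ∈ E, a i ^ 2 - 2 * (∑ i ∈ E, a i) ^ 2 := by
    have : ∀ i j, (a i - a j) ^ 2 = a i ^ 2 - 2 * a i * a j + a j ^ 2 := fun i j => by ring
    simp only [this, sum_add_distrib, sum_sub_distrib, sum_const, nsmul_eq_mul, ← mul_sum,
      ← sum_mul]
    ring
  rw [h1, h2]
  field_simp
  ring

/-- The barycenter value of a hyperedge as a sum over pairs. -/
theorem bar_eq [Fintype V] [DecidableEq V] (f : V → ProbabilityMeasure ℝ) (E : Finset V) :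
    bar f E = ENNReal.ofReal (1 / (E.card : ℝ) ^ 2) *
      (2⁻¹ * ∑ i ∈ E, ∑ j ∈ E, W2sq (f i) (f j)) := by
  rcases E.eq_empty_or_nonempty with rfl | hE
  · simp [bar]
  have hk : (0 : ℝ) < E.card := by exact_mod_cast card_pos.2 hE
  set P : ℝ → ℝ := fun s => 1 / (E.card : ℝ) ^ 2 *
    (2⁻¹ * ∑ i ∈ E, ∑ j ∈ E, (quantile (f i) s - quantile (f j) s) ^ 2) with hP
  have hcost : ∀ ν : ProbabilityMeasure ℝ, (E.card : ℝ≥0∞)⁻¹ * ∑ i ∈ E, W2sq (f i) ν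
      = ∫⁻ s, ENNReal.ofReal (P s +
          ((E.card : ℝ)⁻¹ * ∑ i ∈ E, quantile (f i) s - quantile ν s) ^ 2) ∂unif := by
    intro ν
    simp only [W2sq_eq_lintegral_sq]
    rw [← lintegral_finsetSum' _ fun i _ => aemeasurable_quantile_sub_sq _ _,
      ← lintegral_const_mul'' _ (Finset.aemeasurable_fun_sum _ fun i _ =>
        aemeasurable_quantile_sub_sq _ _)]
    refine lintegral_congr fun s => ?_
    rw [← sum_sub_sq_eq E hE (fun i => quantile (f i) s), ENNReal.ofReal_mul (by positivity),
      ENNReal.ofReal_inv_of_pos hk, ENNReal.ofReal_natCast,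
      ENNReal.ofReal_sum_of_nonneg fun _ _ => sq_nonneg _]
  have hpairs : ∫⁻ s, ENNReal.ofReal (P s) ∂unif = ENNReal.ofReal (1 / (E.card : ℝ) ^ 2) *
      (2⁻¹ * ∑ i ∈ E, ∑ j ∈ E, W2sq (f i) (f j)) := by
    have hB := fun i : V => Finset.aemeasurable_fun_sum E fun j _ =>
      aemeasurable_quantile_sub_sq (f i) (f j)
    simp only [W2sq_eq_lintegral_sq]
    simp only [← lintegral_finsetSum' _ fun j _ => aemeasurable_quantile_sub_sq _ _]
    rw [← lintegral_finsetSum' _ fun i _ => hB i,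
      ← lintegral_const_mul'' _ (Finset.aemeasurable_fun_sum _ fun i _ => hB i),
      ← lintegral_const_mul'' _ ((Finset.aemeasurable_fun_sum _ fun i _ => hB i).const_mul _)]
    refine lintegral_congr fun s => ?_
    simp only [hP]
    rw [ENNReal.ofReal_mul (by positivity), ENNReal.ofReal_mul (by norm_num),
      ENNReal.ofReal_inv_of_pos two_pos, ENNReal.ofReal_ofNat,
      ENNReal.ofReal_sum_of_nonneg fun _ _ => sum_nonneg fun _ _ => sq_nonneg _]
    simp only [ENNReal.ofReal_sum_of_nonneg fun _ _ => sq_nonneg _]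
  rw [← hpairs]
  apply le_antisymm
  -- An average of quantile functions is monotone, so some ν has it as quantile function and makes
  -- the bias vanish.
  · have hmono : MonotoneOn (fun s => (E.card : ℝ)⁻¹ * ∑ i ∈ E, quantile (f i) s)
        (Set.Ioo 0 1) := fun s hs t ht hst =>
      mul_le_mul_of_nonneg_left (sum_le_sum fun i _ => monotoneOn_quantile _ hs ht hst)
        (by positivity)
    obtain ⟨ν, hν⟩ := exists_quantile_ae_eq hmono
    refine (iInf_le _ ν).trans_eq ?_
    rw [hcost]
    refine lintegral_congr_ae ?_
    filter_upwards [hν] with s hs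
    rw [hs]; simp
  · refine le_iInf fun ν => ?_
    rw [hcost]
    exact lintegral_mono fun s => ENNReal.ofReal_le_ofReal (le_add_of_nonneg_right (sq_nonneg _))

/-- The hypergraph objective is the objective of the weighted clique graph. -/
theorem hypergraphObjective_eq [Fintype V] [DecidableEq V] (𝓔 : Finset (Finset V)) (γ : ℝ) {m : ℕ}
    (S : Fin m → V × ProbabilityMeasure ℝ) (f : V → ProbabilityMeasure ℝ) :
    hypergraphObjective 𝓔 γ S f = graphObjective (cliqueGraph 𝓔) γ S f := by
  have hw : ∀ i j, ENNReal.ofReal ((cliqueGraph 𝓔).weight i j) * W2sq (f i) (f j)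
      = ∑ E ∈ 𝓔, if i ∈ E ∧ j ∈ E then
          ENNReal.ofReal (1 / (E.card : ℝ) ^ 2) * W2sq (f i) (f j) else 0 := by
    intro i j
    -- The clique graph has no loops, while the hyperedge sums include the diagonal; the diagonal
    -- terms vanish because the distance does.
    by_cases hij : i = j
    · subst hij; simp [W2sq_self]
    · have : (cliqueGraph 𝓔).weight i j
          = ∑ E ∈ 𝓔.filter (fun E => i ∈ E ∧ j ∈ E), 1 / (E.card : ℝ) ^ 2 := if_neg hij
      rw [this, ENNReal.ofReal_sum_of_nonneg fun _ _ => by positivity, sum_mul, sum_filter]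
  have hbar : ∀ E, bar f E = 2⁻¹ * ∑ i, ∑ j, if i ∈ E ∧ j ∈ E then
      ENNReal.ofReal (1 / (E.card : ℝ) ^ 2) * W2sq (f i) (f j) else 0 := by
    intro E
    rw [bar_eq, mul_left_comm, mul_sum]
    congr 1
    simp only [mul_sum]
    rw [← sum_filter_add_sum_filter_not univ (· ∈ E)]
    have h0 : ∑ i ∈ univ.filter (fun i => ¬ i ∈ E), ∑ j, (if i ∈ E ∧ j ∈ E then
        ENNReal.ofReal (1 / (E.card : ℝ) ^ 2) * W2sq (f i) (f j) else 0) = 0 :=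
      sum_eq_zero fun i hi => sum_eq_zero fun j _ => by
        rw [if_neg fun h => (mem_filter.1 hi).2 h.1]
    rw [h0, add_zero, filter_mem_eq_inter, univ_inter]
    refine sum_congr rfl fun i hi => ?_
    simp only [hi, true_and]
    rw [sum_ite_mem, univ_inter]
  rw [hypergraphObjective, graphObjective]
  congr 2
  simp only [hw, hbar, ← mul_sum]
  congr 1
  rw [sum_comm]
  exact sum_congr rfl fun i _ => sum_comm

end Hypergraph

/-! ### Measurable cost function and its uniform stability -/

section Cost

open Finset

/-- The quantile function, truncated to the band `[-ψ, ψ]`. -/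
noncomputable def truncQuantile (ψ : ℝ → ℝ) (μ : ProbabilityMeasure ℝ) (s : ℝ) : ℝ :=
  max (-ψ s) (min (ψ s) ((Prod.snd ⁻¹' Set.Ioo (0 : ℝ) 1).indicator
    (fun p : ProbabilityMeasure ℝ × ℝ => quantile p.1 p.2) (μ, s)))

/-- Purpose of the truncation: the bound holds for every measure and every level, so the cost is
stable under arbitrary replacements and not only for samples in the dominated class. -/
theorem abs_truncQuantile_le {ψ : ℝ → ℝ} (hψ : ∀ s, 0 ≤ ψ s) (μ : ProbabilityMeasure ℝ) (s : ℝ) :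
    |truncQuantile ψ μ s| ≤ ψ s :=
  abs_le.2 ⟨le_max_left _ _, max_le (by linarith [hψ s]) (min_le_left _ _)⟩

theorem measurable_truncQuantile {ψ : ℝ → ℝ} (hψ : Measurable ψ) :
    Measurable fun p : ProbabilityMeasure ℝ × ℝ => truncQuantile ψ p.1 p.2 :=
  (hψ.comp measurable_snd).neg.max ((hψ.comp measurable_snd).min measurable_quantile_prod)

theorem truncQuantile_ae_eq {ψ : ℝ → ℝ} {μ : ProbabilityMeasure ℝ}
    (h : ∀ᵐ s ∂unif, |quantile μ s| ≤ ψ s) : ∀ᵐ s ∂unif, truncQuantile ψ μ s = quantile μ s := by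
  filter_upwards [h, ae_unif_mem] with s hs hs'
  obtain ⟨h1, h2⟩ := abs_le.1 hs
  have : (Prod.snd ⁻¹' Set.Ioo (0 : ℝ) 1).indicator
      (fun p : ProbabilityMeasure ℝ × ℝ => quantile p.1 p.2) (μ, s) = quantile μ s :=
    Set.indicator_of_mem (s := Prod.snd ⁻¹' Set.Ioo (0 : ℝ) 1) (a := (μ, s)) hs' _
  rw [truncQuantile, this, min_eq_right h2, max_eq_right h1]

theorem quantile_sq_lintegral_ne_top {ψ : ℝ → ℝ} (hψ2 : Integrable (fun s => ψ s ^ 2) unif)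
    {μ : ProbabilityMeasure ℝ} (hμ : ∀ᵐ s ∂unif, |quantile μ s| ≤ ψ s) :
    ∫⁻ s, ENNReal.ofReal (quantile μ s ^ 2) ∂unif ≠ ∞ := by
  refine ne_top_of_le_ne_top hψ2.lintegral_lt_top.ne (lintegral_mono_ae ?_)
  filter_upwards [hμ] with s hs
  refine ENNReal.ofReal_le_ofReal ?_
  rw [← sq_abs]
  exact pow_le_pow_left₀ (abs_nonneg _) hs 2

variable {V : Type*} [Fintype V] [DecidableEq V] (G : WeightedGraph V)

/-- The difference of the propagated quantiles of the training set `S` and of the quantile of the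
test label, at the level `s`. -/
noncomputable def residual (c : ℝ) (ψ : ℝ → ℝ) {m : ℕ} (S : Fin m → V × ProbabilityMeasure ℝ)
    (z : V × ProbabilityMeasure ℝ) (s : ℝ) : ℝ :=
  G.propagate c univ (fun i => (S i).1) (fun i => truncQuantile ψ (S i).2 s) z.1
    - truncQuantile ψ z.2 s

/-- The cost of the propagated labels at a test point. -/
noncomputable def propagationCost (c : ℝ) (ψ : ℝ → ℝ) {m : ℕ}
    (S : Fin m → V × ProbabilityMeasure ℝ) (z : V × ProbabilityMeasure ℝ) : ℝ :=
  ∫ s, residual G c ψ S z s ^ 2 ∂unif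

variable {G} {c : ℝ} {ψ : ℝ → ℝ} {m : ℕ}

theorem measurable_residual [MeasurableSpace V] [MeasurableSingletonClass V] (hψ : Measurable ψ) :
    Measurable fun p : ((Fin m → V × ProbabilityMeasure ℝ) × (V × ProbabilityMeasure ℝ)) × ℝ =>
      residual G c ψ p.1.1 p.1.2 p.2 := by
  have hq := measurable_truncQuantile hψ
  unfold residual
  simp only [G.propagate_eq_sum]
  refine (Finset.measurable_fun_sum _ fun i _ => Measurable.mul ?_ ?_).sub ?_
  -- The propagation coefficients depend only on finitely many vertex configurations, so they are
  -- measurable without further argument.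
  · exact (measurable_of_finite fun w : (Fin m → V) × V =>
      (G.screened c (scatter univ w.1 1))⁻¹ w.2 (w.1 i)).comp
      (f := fun p : ((Fin m → V × ProbabilityMeasure ℝ) × (V × ProbabilityMeasure ℝ)) × ℝ =>
        ((fun i => (p.1.1 i).1 : Fin m → V), p.1.2.1)) (by fun_prop)
  · exact hq.comp
      (f := fun p : ((Fin m → V × ProbabilityMeasure ℝ) × (V × ProbabilityMeasure ℝ)) × ℝ =>
        ((p.1.1 i).2, p.2)) (by fun_prop)
  · exact hq.comp
      (f := fun p : ((Fin m → V × ProbabilityMeasure ℝ) × (V × ProbabilityMeasure ℝ)) × ℝ =>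
        (p.1.2.2, p.2)) (by fun_prop)

theorem abs_residual_le (hG : G.graph.Connected) (hc : 0 < c) (hψ0 : ∀ s, 0 ≤ ψ s) (hm : 0 < m)
    (S : Fin m → V × ProbabilityMeasure ℝ) (z : V × ProbabilityMeasure ℝ) (s : ℝ) :
    |residual G c ψ S z s| ≤ 2 * ψ s := by
  have : Nonempty (Fin m) := ⟨⟨0, hm⟩⟩
  have h1 := G.abs_propagate_le hG hc univ_nonempty (v := fun i => (S i).1)
    (y := fun i => truncQuantile ψ (S i).2 s) (fun i _ => abs_truncQuantile_le hψ0 _ s) z.1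
  have h2 := abs_truncQuantile_le hψ0 z.2 s
  exact (abs_sub _ _).trans (by linarith)

variable [MeasurableSpace V] [MeasurableSingletonClass V]

theorem measurable_residual_level (hψ : Measurable ψ) (S : Fin m → V × ProbabilityMeasure ℝ)
    (z : V × ProbabilityMeasure ℝ) : Measurable (residual G c ψ S z) :=
  (measurable_residual (G := G) (c := c) (m := m) hψ).comp
    (f := fun s : ℝ => ((S, z), s)) measurable_prodMk_left

theorem integrable_residual_sq (hG : G.graph.Connected) (hc : 0 < c) (hψ : Measurable ψ)
    (hψ0 : ∀ s, 0 ≤ ψ s) (hψ2 : Integrable (fun s => ψ s ^ 2) unif) (hm : 0 < m)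
    (S : Fin m → V × ProbabilityMeasure ℝ) (z : V × ProbabilityMeasure ℝ) :
    Integrable (fun s => residual G c ψ S z s ^ 2) unif := by
  refine (hψ2.const_mul 4).mono' ((measurable_residual_level hψ S z).pow_const 2).aestronglyMeasurable
    (ae_of_all _ fun s => ?_)
  rw [norm_pow, Real.norm_eq_abs]
  calc _ ≤ (2 * ψ s) ^ 2 := pow_le_pow_left₀ (abs_nonneg _) (abs_residual_le hG hc hψ0 hm S z s) 2
    _ = _ := by ring

/-- Uniform stability of the propagation cost. -/
theorem uniformlyStable_propagationCost (hG : G.graph.Connected) (hc : 0 < c) {l : ℝ} (hl0 : 0 < l)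
    (hl : G.IsSpectralGap l) (hψ : Measurable ψ) (hψ0 : ∀ s, 0 ≤ ψ s)
    (hψ2 : Integrable (fun s => ψ s ^ 2) unif) (hm : 2 ≤ m) :
    UniformlyStable (propagationCost G c ψ (m := m)) (4 * ∫ s, ψ s ^ 2 ∂unif)
      (8 * (1 / m + 2 / (c * l)) * ∫ s, ψ s ^ 2 ∂unif) := by
  have hm0 : 0 < m := by omega
  have hintegral := integrable_residual_sq (G := G) (m := m) hG hc hψ hψ0 hψ2 hm0
  refine ⟨?_, fun S z => integral_nonneg fun s => sq_nonneg _, fun S z => ?_, fun S i w z => ?_⟩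
  · exact (StronglyMeasurable.integral_prod_right
      ((measurable_residual hψ).pow_const 2).stronglyMeasurable).measurable
  · rw [← integral_const_mul]
    refine integral_mono (hintegral S z) (hψ2.const_mul 4) fun s => ?_
    have h := abs_residual_le hG hc hψ0 hm0 S z s
    calc _ ≤ (2 * ψ s) ^ 2 := by rw [← sq_abs]; exact pow_le_pow_left₀ (abs_nonneg _) h 2
      _ = _ := by ring
  · rw [propagationCost, propagationCost, ← integral_sub (hintegral _ z) (hintegral S z),
      ← integral_const_mul]
    refine (norm_integral_le_of_norm_le (f := fun s => residual G c ψ (Function.update S i w) z s ^ 2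
      - residual G c ψ S z s ^ 2) (hψ2.const_mul (8 * (1 / m + 2 / (c * l))))
      (ae_of_all _ fun s => ?_))
    -- Here m ≥ 2 enters: a label must remain after deletion for the reduced system to be
    -- invertible.
    have hne : ((univ : Finset (Fin m)).erase i).Nonempty := by
      rw [← card_pos, card_erase_of_mem (mem_univ i), card_univ, Fintype.card_fin]; omega
    have h1 := G.abs_propagate_sub_propagate_le hG hc hl0 hl (mem_univ i) hne
      (v := fun j => (Function.update S i w j).1) (v' := fun j => (S j).1)
      (y := fun j => truncQuantile ψ (Function.update S i w j).2 s)
      (y' := fun j => truncQuantile ψ (S j).2 s)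
      (fun j _ => abs_truncQuantile_le hψ0 _ s) (fun j _ => abs_truncQuantile_le hψ0 _ s)
      (fun j _ hj => by rw [Function.update_of_ne hj])
      (fun j _ hj => by rw [Function.update_of_ne hj]) z.1
    rw [card_univ, Fintype.card_fin] at h1
    have h2 : residual G c ψ (Function.update S i w) z s - residual G c ψ S z s
        = G.propagate c univ (fun j => (Function.update S i w j).1)
            (fun j => truncQuantile ψ (Function.update S i w j).2 s) z.1
          - G.propagate c univ (fun j => (S j).1) (fun j => truncQuantile ψ (S j).2 s) z.1 := by
      simp only [residual]; ring
    rw [← h2] at h1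
    have h3 := abs_residual_le hG hc hψ0 hm0 (Function.update S i w) z s
    have h4 := abs_residual_le hG hc hψ0 hm0 S z s
    set a := residual G c ψ (Function.update S i w) z s
    set b := residual G c ψ S z s
    have h5 : |a + b| ≤ 4 * ψ s := (abs_add_le _ _).trans (by linarith)
    -- The sum of the residuals is at most 4ψ and their difference at most 2κψ, which gives the
    -- constant 8κ.
    rw [Real.norm_eq_abs, sq_sub_sq, abs_mul]
    calc |a + b| * |a - b| ≤ 4 * ψ s * (2 * (1 / (m : ℝ) + 2 / (c * l)) * ψ s) :=
          mul_le_mul h5 h1 (abs_nonneg _) (by linarith [hψ0 s])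
      _ = _ := by ring

/-- The transport cost of a minimizer is the propagation cost. -/
theorem W2sq_minimizer_eq {γ : ℝ} (hG : G.graph.Connected) (hγ : 0 < γ) (hψ : Measurable ψ)
    (hψ0 : ∀ s, 0 ≤ ψ s) (hψ2 : Integrable (fun s => ψ s ^ 2) unif) (hm : 0 < m)
    {S : Fin m → V × ProbabilityMeasure ℝ}
    (hS : ∀ i, ∀ᵐ s ∂unif, |quantile (S i).2 s| ≤ ψ s)
    {f : V → ProbabilityMeasure ℝ} (hf : ∀ g, graphObjective G γ S f ≤ graphObjective G γ S g)
    {z : V × ProbabilityMeasure ℝ} (hz : ∀ᵐ s ∂unif, |quantile z.2 s| ≤ ψ s) :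
    W2sq (f z.1) z.2 = ENNReal.ofReal (propagationCost G (m * γ) ψ S z) := by
  have hc : 0 < m * γ := mul_pos (by exact_mod_cast hm) hγ
  have hmin := quantile_minimizer_ae_eq hG hγ hm
    (fun i => quantile_sq_lintegral_ne_top hψ2 (hS i)) hf
  have hS' : ∀ᵐ s ∂unif, ∀ i, truncQuantile ψ (S i).2 s = quantile (S i).2 s :=
    ae_all_iff.2 fun i => truncQuantile_ae_eq (hS i)
  rw [W2sq_eq_lintegral_sq, propagationCost, ofReal_integral_eq_lintegral_ofReal
    (integrable_residual_sq hG hc hψ hψ0 hψ2 hm S z) (ae_of_all _ fun s => sq_nonneg _)]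
  refine lintegral_congr_ae ?_
  filter_upwards [hmin, hS', truncQuantile_ae_eq hz] with s h1 h2 h3
  simp only [residual, h1, h2, h3]

end Cost

/-! ### From stability to the stated bounds -/

section Bounds

open Finset

variable {V : Type*} [MeasurableSpace V]

theorem riskGap_eq {D : Measure (V × ProbabilityMeasure ℝ)} [IsProbabilityMeasure D] {m : ℕ}
    (hm : 0 < m) {c : (Fin m → V × ProbabilityMeasure ℝ) → V × ProbabilityMeasure ℝ → ℝ} {M β : ℝ}
    (hc : UniformlyStable c M β) {S : Fin m → V × ProbabilityMeasure ℝ}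
    {f : V → ProbabilityMeasure ℝ}
    (hS : ∀ i, W2sq (f (S i).1) (S i).2 = ENNReal.ofReal (c S (S i)))
    (hD : ∀ᵐ z ∂D, W2sq (f z.1) z.2 = ENNReal.ofReal (c S z)) :
    riskGap D S f = |generalizationGap D c S| := by
  have hm' : (0 : ℝ) < m := by exact_mod_cast hm
  have h1 : (empiricalRisk S f).toReal = (m : ℝ)⁻¹ * ∑ i, c S (S i) := by
    simp only [empiricalRisk, hS]
    rw [← ENNReal.ofReal_sum_of_nonneg fun i _ => hc.nonneg _ _, ENNReal.toReal_mul,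
      ENNReal.toReal_ofReal (sum_nonneg fun i _ => hc.nonneg _ _), ENNReal.toReal_inv,
      ENNReal.toReal_natCast]
  have h2 : (trueRisk D f).toReal = ∫ z, c S z ∂D := by
    rw [trueRisk, lintegral_congr_ae hD, ← ofReal_integral_eq_lintegral_ofReal
      (hc.integrable D S) (ae_of_all _ fun z => hc.nonneg S z),
      ENNReal.toReal_ofReal (hc.risk_mem D S).1]
  rw [riskGap, h1, h2, generalizationGap, abs_sub_comm]

variable [Fintype V] [DecidableEq V]

theorem generalizationBounds_of_stable {D : Measure (V × ProbabilityMeasure ℝ)}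
    [IsProbabilityMeasure D] {m : ℕ} (hm : 0 < m)
    {c : (Fin m → V × ProbabilityMeasure ℝ) → V × ProbabilityMeasure ℝ → ℝ} {M β₀ β : ℝ}
    (hM : 0 ≤ M) (hβ₀ : 0 ≤ β₀) (hβ : β₀ ≤ β) (hβM : M = 0 → β = 0) (hc : UniformlyStable c M β₀)
    {A : (Fin m → V × ProbabilityMeasure ℝ) → V → ProbabilityMeasure ℝ}
    (hA : ∀ᵐ S ∂(Measure.pi fun _ : Fin m => D), riskGap D S (A S) = |generalizationGap D c S|)
    (T : ℕ) : GeneralizationBounds D A T M β := by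
  have hm' : (0 : ℝ) < m := by exact_mod_cast hm
  intro ε hε
  -- The bad event is almost contained in a measurable event for the gap of c, so A itself need not
  -- be measurable.
  have hsub : ∀ t t' : ℝ, t' ≤ t → (Measure.pi fun _ : Fin m => D)
      {S | maxMultiplicity S ≤ T ∧ t < riskGap D S (A S)}
      ≤ (Measure.pi fun _ : Fin m => D) {S | t' < |generalizationGap D c S|} := by
    intro t t' ht
    refine measure_mono_ae ?_
    filter_upwards [hA] with S hS h
    change t' < _
    rw [← hS]
    exact ht.trans_lt h.2
  refine ⟨fun _ => ?_, ?_⟩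
  · refine (hsub ε ε le_rfl).trans ((hc.measure_gap_gt_le D hm hε).trans
      (ENNReal.ofReal_le_ofReal ?_))
    rw [← div_div]
    refine div_le_div_of_nonneg_right ?_ (by positivity)
    rw [add_div, mul_div_assoc (64 * M * m)]
    have e1 : 64 * M * m * (β / m) = 64 * (M * β) := by field_simp
    have e2 : 8 * M ^ 2 / m = 8 * (M ^ 2 / m) := by ring
    have h1 : M * β₀ ≤ M * β := mul_le_mul_of_nonneg_left hβ hM
    have h2 : 0 ≤ M * β₀ := mul_nonneg hM hβ₀
    have h3 : 0 ≤ M ^ 2 / m := by positivity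
    rw [e1, e2]
    linarith
  · refine (hsub (ε + β) (ε + β₀) (by linarith)).trans ((hc.measure_gap_gt_add_le D hm hε).trans
      (ENNReal.ofReal_le_ofReal (mul_le_mul_of_nonneg_left (Real.exp_le_exp.2 (neg_le_neg ?_))
        two_pos.le)))
    -- For M = 0 also β = 0, and division by zero makes the target exponent 0, so the bound reads 2.
    rcases hM.eq_or_lt with h0 | h0
    · rw [hβM h0.symm, ← h0]
      simp only [mul_zero, add_zero, ne_eq, OfNat.ofNat_ne_zero, not_false_eq_true, zero_pow,
        div_zero]
      positivity
    -- McDiarmid yields M/2 in the denominator; enlarging it to M and β₀ to β gives the required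
    -- form.
    · have e : 2 * ε ^ 2 / (m * (2 * β₀ + M / m) ^ 2) = m * ε ^ 2 / (2 * (m * β₀ + M / 2) ^ 2) := by
        have : 0 < m * β₀ + M / 2 := by positivity
        have : 0 < 2 * β₀ + M / m := by positivity
        field_simp
      rw [e]
      have : 0 < m * β₀ + M / 2 := by positivity
      gcongr
      linarith

theorem generalizationBounds_graph [MeasurableSingletonClass V] {φ : ℝ → ℝ}
    (hφ : MemLp φ 2 (volume.restrict (Set.Icc (0 : ℝ) 1)))
    (hφ0 : ∀ s ∈ Set.Icc (0 : ℝ) 1, 0 ≤ φ s)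
    {D : Measure (V × ProbabilityMeasure ℝ)} [IsProbabilityMeasure D]
    (hD : ∀ᵐ z ∂D, z.2 ∈ dominatedQuantileClass φ)
    {m : ℕ} (hm : 4 ≤ m) {γ : ℝ} (hγ : 0 < γ) {T : ℕ} (hT : 0 < T)
    {G : WeightedGraph V} {l : ℝ} (hG : G.graph.Connected) (hl : G.IsSpectralGap l)
    (hTl : (T : ℝ) < m * γ * l)
    {A : (Fin m → V × ProbabilityMeasure ℝ) → V → ProbabilityMeasure ℝ}
    (hA : ∀ᵐ S ∂(Measure.pi fun _ : Fin m => D), ∀ f, graphObjective G γ S (A S) ≤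
      graphObjective G γ S f) :
    GeneralizationBounds D A T (4 * sqNorm φ) (beta φ m T γ l) := by
  have hm0 : 0 < m := by omega
  have hm' : (0 : ℝ) < m := by exact_mod_cast hm0
  have hT' : (0 : ℝ) < T := by exact_mod_cast hT
  have hc : 0 < m * γ := mul_pos hm' hγ
  have hl0 : 0 < l := pos_of_mul_pos_right (hT'.trans hTl) hc.le
  rw [← unif_eq_restrict_Icc] at hφ
  -- A representative of φ that is Borel and nonnegative everywhere, as the truncation requires.
  obtain ⟨ψ, hψ, hψ0, hψφ⟩ : ∃ ψ : ℝ → ℝ, Measurable ψ ∧ (∀ s, 0 ≤ ψ s) ∧ φ =ᵐ[unif] ψ := by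
    refine ⟨fun s => |hφ.1.mk φ s|, hφ.1.stronglyMeasurable_mk.measurable.abs,
      fun s => abs_nonneg _, ?_⟩
    filter_upwards [hφ.1.ae_eq_mk, ae_unif_mem] with s hs hs'
    rw [← hs, abs_of_nonneg (hφ0 s ⟨hs'.1.le, hs'.2.le⟩)]
  have hψ2 : Integrable (fun s => ψ s ^ 2) unif := ((memLp_congr_ae hψφ).1 hφ).integrable_sq
  have hnorm : sqNorm φ = ∫ s, ψ s ^ 2 ∂unif := by
    rw [sqNorm, ← unif_eq_restrict_Icc]
    refine integral_congr_ae ?_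
    filter_upwards [hψφ] with s hs
    rw [hs]
  have hclass : ∀ μ ∈ dominatedQuantileClass φ, ∀ᵐ s ∂unif, |quantile μ s| ≤ ψ s := by
    intro μ hμ
    have hμ' : ∀ᵐ s ∂unif, |quantile μ s| ≤ φ s := by rw [unif_eq_restrict_Icc]; exact hμ
    filter_upwards [hμ', hψφ] with s hs hs'
    rwa [← hs']
  have hstable := uniformlyStable_propagationCost (m := m) hG hc hl0 hl hψ hψ0 hψ2 (by omega)
  rw [← hnorm] at hstable
  have hN : 0 ≤ sqNorm φ := hnorm ▸ integral_nonneg fun s => sq_nonneg _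
  have hcl : 0 < m * γ * l := mul_pos hc hl0
  refine generalizationBounds_of_stable hm0 (by positivity) (by positivity) ?_ ?_ hstable ?_ T
  -- The proven constant is 4‖φ‖₂²[4/(mγλ₁) + 2/m]; subtracting T in the denominator and adding the
  -- square root term only enlarge it.
  · have h1 : 2 / (m * γ * l) ≤ 2 / (m * γ * l - T) :=
      div_le_div_of_nonneg_left (by norm_num) (by linarith) (by linarith)
    have h2 : 0 ≤ 3 * √((T : ℝ) * m) / (m * γ * l - T) ^ 2 := by positivity
    rw [beta]
    calc 8 * (1 / (m : ℝ) + 2 / (m * γ * l)) * sqNorm φ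
        = 4 * sqNorm φ * (2 * (2 / (m * γ * l)) + 2 / m) := by ring
      _ ≤ 4 * sqNorm φ * (3 * √((T : ℝ) * m) / (m * γ * l - T) ^ 2
          + 2 * (2 / (m * γ * l - T)) + 2 / m) := by
          refine mul_le_mul_of_nonneg_left ?_ (by positivity)
          linarith
      _ = _ := by ring
  · intro h
    rw [beta, h, zero_mul]
  · have hS : ∀ᵐ S ∂(Measure.pi fun _ : Fin m => D), ∀ i, (S i).2 ∈ dominatedQuantileClass φ :=
      ae_all_iff.2 fun i => (Measure.quasiMeasurePreserving_eval (fun _ : Fin m => D) i).ae hD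
    filter_upwards [hA, hS] with S hmin hS
    have hS' := fun i => hclass _ (hS i)
    refine riskGap_eq hm0 hstable (fun i => ?_) ?_
    · exact W2sq_minimizer_eq hG hγ hψ hψ0 hψ2 hm0 hS' hmin (hS' i)
    · filter_upwards [hD] with z hz
      exact W2sq_minimizer_eq hG hγ hψ hψ0 hψ2 hm0 hS' hmin (hclass _ hz)

end Bounds

end SoftLabel

open MeasureTheory SoftLabel in
theorem theorem4 {V : Type*} [Fintype V] [DecidableEq V] [MeasurableSpace V]
    [MeasurableSingletonClass V]
    (φ : ℝ → ℝ) (hφ : MemLp φ 2 (volume.restrict (Set.Icc (0 : ℝ) 1)))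
    (hφ0 : ∀ s ∈ Set.Icc (0 : ℝ) 1, 0 ≤ φ s)
    (D : Measure (V × ProbabilityMeasure ℝ)) [IsProbabilityMeasure D]
    (hD : ∀ᵐ z ∂D, z.2 ∈ dominatedQuantileClass φ)
    (m : ℕ) (hm : 4 ≤ m) (γ : ℝ) (hγ : 0 < γ) (T : ℕ) (hT : 0 < T) :
    (∀ (G : WeightedGraph V) (l : ℝ), G.graph.Connected → G.IsSpectralGap l →
      (T : ℝ) < m * γ * l →
      ∀ A : (Fin m → V × ProbabilityMeasure ℝ) → V → ProbabilityMeasure ℝ,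
        (∀ᵐ S ∂(Measure.pi fun _ : Fin m => D), ∀ f, graphObjective G γ S (A S) ≤
          graphObjective G γ S f) →
        GeneralizationBounds D A T (4 * sqNorm φ) (beta φ m T γ l)) ∧
    (∀ (𝓔 : Finset (Finset V)) (l : ℝ), (cliqueGraph 𝓔).graph.Connected →
      (cliqueGraph 𝓔).IsSpectralGap l → (T : ℝ) < m * γ * l →
      ∀ A : (Fin m → V × ProbabilityMeasure ℝ) → V → ProbabilityMeasure ℝ,
        (∀ᵐ S ∂(Measure.pi fun _ : Fin m => D), ∀ f, hypergraphObjective 𝓔 γ S (A S) ≤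
          hypergraphObjective 𝓔 γ S f) →
        GeneralizationBounds D A T (4 * sqNorm φ) (beta φ m T γ l)) := by
  refine ⟨fun G l hG hl hTl A hA => generalizationBounds_graph hφ hφ0 hD hm hγ hT hG hl hTl hA,
    fun 𝓔 l hG hl hTl A hA => generalizationBounds_graph hφ hφ0 hD hm hγ hT hG hl hTl ?_⟩
  simpa only [hypergraphObjective_eq] using hA
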